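/- **Theorem.** Let $\Gamma$ be a finite compact metric graph: a finite non-empty collection of compact intervals $\Delta_e=[a_e,b_e]$, $a_e<b_e$ (the edges), together with a partition of the set of their endpoints into $N$ non-empty classes $V_1,\dots,V_N$ (the vertices). The valence $\gamma_k$ of $V_k$ is the number of endpoints in $V_k$; put $\Gamma_N=\mathrm{diag}\{\gamma_1,\dots,\gamma_N\}$. For real $\alpha_1,\dots,\alpha_N$ and $B=\mathrm{diag}\{\alpha_1,\dots,\alpha_N\}$ let $A_B$ be the operator $f\mapsto -f''$ in $L_2(\Gamma)=\bigoplus_e L_2(\Delta_e)$ (complex-valued functions) whose domain consists of all $f\in\bigoplus_e W_2^2(\Delta_e)$ that satisfy at every vertex $V_k$ the $\delta$-type matching conditions: $f$ takes one and the same value $f(V_k)$ at all endpoints belonging to $V_k$, and $$\sum_{x\in V_k}\partial_n f(x)=\alpha_k f(V_k),$$ where $\partial_n f(x)=f'(x)$ if $x$ is the left endpoint of its edge and $\partial_n f(x)=-f'(x)$ if $x$ is the right one. Let $B_1=\mathrm{diag}\{\tilde\alpha_1,\dots,\tilde\alpha_N\}$ and $B_2=\mathrm{diag}\{\alpha_1,\dots,\alpha_N\}$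 be real diagonal matrices such that the (point) spectra of $A_{B_1}$ and $A_{B_2}$ on the same graph $\Gamma$ coincide counting multiplicities, i.e. $\dim\ker(A_{B_1}-z)=\dim\ker(A_{B_2}-z)$ for every $z\in\mathbb C$. Put $D=B_1-B_2$. Then for every integer $m\ge 1$ $$\sum_{j=1}^{m}\frac1j\binom{m-1}{m-j}\,\mathrm{Tr}\bigl(D^{j}B_2^{\,m-j}\Gamma_N^{-m}\bigr)=0 .$$ -/

import Mathlib

open MeasureTheory
open scoped ContDiff

noncomputable section

namespace QuantumGraph

/-- The complex Hilbert space `L₂` of the closed interval `[a, b]` with Lebesgue measure. -/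
abbrev EdgeL2 (a b : ℝ) : Type :=
  Lp ℂ 2 (volume.restrict (Set.Icc a b))

/-- `v` is the weak (distributional) derivative of `u` on the open interval `(a, b)`. -/
def HasWeakDeriv {a b : ℝ} (u v : EdgeL2 a b) : Prop :=
  ∀ φ : ℝ → ℝ, ContDiff ℝ ∞ φ → HasCompactSupport φ → tsupport φ ⊆ Set.Ioo a b →
    ∫ x in Set.Icc a b, deriv φ x • u x = - ∫ x in Set.Icc a b, φ x • v x

/-- `c` is the value at the point `x` of the continuous representative of `u` on `[a, b]`. -/
def HasValueAt {a b : ℝ} (u : EdgeL2 a b) (x : ℝ) (c : ℂ) : Prop :=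
  ∃ f : ℝ → ℂ, ContinuousOn f (Set.Icc a b) ∧
    (∀ᵐ y ∂(volume.restrict (Set.Icc a b)), u y = f y) ∧ f x = c

theorem EdgeL2.integrable {a b : ℝ} (u : EdgeL2 a b) :
    Integrable (fun x => u x) (volume.restrict (Set.Icc a b)) :=
  (Lp.memLp u).integrable (by norm_num)

theorem EdgeL2.integrable_smul {a b : ℝ} (u : EdgeL2 a b) {φ : ℝ → ℝ}
    (hφ : Continuous φ) (hc : HasCompactSupport φ) :
    Integrable (fun x => φ x • u x) (volume.restrict (Set.Icc a b)) := by
  obtain ⟨C, hC⟩ := hc.exists_bound_of_continuous hφ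
  exact (EdgeL2.integrable u).bdd_smul C hφ.aestronglyMeasurable
    (Filter.Eventually.of_forall hC)

theorem HasWeakDeriv.zero {a b : ℝ} : HasWeakDeriv (0 : EdgeL2 a b) 0 := by
  intro φ _ _ _
  have h : ∀ ψ : ℝ → ℝ, ∫ x in Set.Icc a b, ψ x • (0 : EdgeL2 a b) x = 0 := by
    intro ψ
    apply integral_eq_zero_of_ae
    filter_upwards [Lp.coeFn_zero ℂ 2 (volume.restrict (Set.Icc a b))] with x hx
    rw [hx]
    simp
  rw [h, h, neg_zero]

theorem HasWeakDeriv.add {a b : ℝ} {u v u₁ v₁ : EdgeL2 a b}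
    (h : HasWeakDeriv u v) (h₁ : HasWeakDeriv u₁ v₁) : HasWeakDeriv (u + u₁) (v + v₁) := by
  intro φ hs hc ht
  have key : ∀ (ψ : ℝ → ℝ) (_ : Continuous ψ) (_ : HasCompactSupport ψ) (w w₁ : EdgeL2 a b),
      ∫ x in Set.Icc a b, ψ x • (w + w₁) x =
        (∫ x in Set.Icc a b, ψ x • w x) + ∫ x in Set.Icc a b, ψ x • w₁ x := by
    intro ψ hψ hψc w w₁
    rw [← integral_add (w.integrable_smul hψ hψc) (w₁.integrable_smul hψ hψc)]
    apply integral_congr_ae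
    filter_upwards [Lp.coeFn_add w w₁] with x hx
    rw [hx, Pi.add_apply, smul_add]
  rw [key _ (hs.continuous_deriv (by simp)) hc.deriv, key _ hs.continuous hc,
    h φ hs hc ht, h₁ φ hs hc ht]
  ring

theorem HasWeakDeriv.smul {a b : ℝ} {u v : EdgeL2 a b} (c : ℂ)
    (h : HasWeakDeriv u v) : HasWeakDeriv (c • u) (c • v) := by
  intro φ hs hc ht
  have key : ∀ (ψ : ℝ → ℝ) (w : EdgeL2 a b),
      ∫ x in Set.Icc a b, ψ x • (c • w) x = c * ∫ x in Set.Icc a b, ψ x • w x := by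
    intro ψ w
    rw [← integral_const_mul]
    apply integral_congr_ae
    filter_upwards [Lp.coeFn_smul c w] with x hx
    simp only [hx, Pi.smul_apply, smul_eq_mul, Complex.real_smul]
    ring
  rw [key, key, h φ hs hc ht]
  ring

/-- The weak derivative is unique. -/
theorem HasWeakDeriv.eq_zero {a b : ℝ} {v : EdgeL2 a b}
    (h : HasWeakDeriv (0 : EdgeL2 a b) v) : v = 0 := by
  have hv : ∀ φ : ℝ → ℝ, ContDiff ℝ ∞ φ → HasCompactSupport φ → tsupport φ ⊆ Set.Ioo a b →
      ∫ x in Set.Icc a b, φ x • v x = 0 := by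
    intro φ hs hc ht
    have h1 := h φ hs hc ht
    have h2 : ∫ x in Set.Icc a b, deriv φ x • (0 : EdgeL2 a b) x = 0 := by
      apply integral_eq_zero_of_ae
      filter_upwards [Lp.coeFn_zero ℂ 2 (volume.restrict (Set.Icc a b))] with x hx
      rw [hx]
      simp
    rw [h2] at h1
    exact neg_eq_zero.1 h1.symm
  have h3 := isOpen_Ioo.ae_eq_zero_of_integral_contDiff_smul_eq_zero
    (U := Set.Ioo a b) (μ := volume.restrict (Set.Icc a b)) (f := fun x => v x)
    ((EdgeL2.integrable v).locallyIntegrable.locallyIntegrableOn _) hv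
  apply Lp.ext
  have h4 : ∀ᵐ x ∂(volume.restrict (Set.Icc a b)), x ∈ Set.Ioo a b := by
    rw [← restrict_Ioo_eq_restrict_Icc]
    exact ae_restrict_mem measurableSet_Ioo
  filter_upwards [h3, h4, Lp.coeFn_zero ℂ 2 (volume.restrict (Set.Icc a b))] with x hx hx' h0
  rw [hx hx', h0]
  rfl

theorem HasValueAt.zero {a b : ℝ} (x : ℝ) : HasValueAt (0 : EdgeL2 a b) x 0 :=
  ⟨fun _ => 0, continuousOn_const, Lp.coeFn_zero ℂ 2 (volume.restrict (Set.Icc a b)), rfl⟩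

theorem HasValueAt.add {a b x : ℝ} {u v : EdgeL2 a b} {c d : ℂ}
    (h : HasValueAt u x c) (h₁ : HasValueAt v x d) : HasValueAt (u + v) x (c + d) := by
  obtain ⟨f, hf, hu, rfl⟩ := h
  obtain ⟨g, hg, hv, rfl⟩ := h₁
  refine ⟨fun y => f y + g y, hf.add hg, ?_, rfl⟩
  filter_upwards [hu, hv, Lp.coeFn_add u v] with y h1 h2 h3
  rw [h3, Pi.add_apply, h1, h2]

theorem HasValueAt.smul {a b x : ℝ} {u : EdgeL2 a b} {d : ℂ} (c : ℂ)
    (h : HasValueAt u x d) : HasValueAt (c • u) x (c * d) := by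
  obtain ⟨f, hf, hu, rfl⟩ := h
  refine ⟨fun y => c * f y, continuousOn_const.mul hf, ?_, rfl⟩
  filter_upwards [hu, Lp.coeFn_smul c u] with y h1 h3
  rw [h3, Pi.smul_apply, h1, smul_eq_mul]

/-- A compact metric graph with edge set `E` and vertex set `V` (finite when `E` is finite):
a nonempty family of nondegenerate closed intervals `[left e, right e]`, together with a partition
of their endpoints into classes labelled by `V`.  The left endpoint of the edge `e` is
`(e, false)`, the right endpoint is `(e, true)`, and the endpoint `x` belongs to the class
`vertexOf x`; as the classes of a partition are nonempty, `vertexOf` is surjective.  Loops,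
multiple edges and disconnected graphs are allowed. -/
structure MetricGraph (E V : Type*) where
  left : E → ℝ
  right : E → ℝ
  left_lt_right : ∀ e, left e < right e
  nonempty_edges : Nonempty E
  vertexOf : E × Bool → V
  vertexOf_surjective : Function.Surjective vertexOf

namespace MetricGraph

variable {E V : Type*} [Fintype E] [DecidableEq V] (G : MetricGraph E V)

/-- The coordinate of an endpoint on its edge. -/
def position (x : E × Bool) : ℝ := if x.2 then G.right x.1 else G.left x.1

/-- The set of all edge endpoints that form the vertex `v`. -/
def endpoints (v : V) : Finset (E × Bool) := Finset.univ.filter fun x => G.vertexOf x = v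

/-- The valence of a vertex: the number of endpoints in its class (a loop counts twice). -/
def valence (v : V) : ℕ := (G.endpoints v).card

/-- The diagonal matrix of vertex valences. -/
def valenceMatrix : Matrix V V ℝ := Matrix.diagonal fun v => (G.valence v : ℝ)

/-- The Hilbert space `L₂(Γ)`, the orthogonal sum of the `L₂` spaces of the edges. -/
abbrev L2 : Type _ := PiLp 2 fun e : E => EdgeL2 (G.left e) (G.right e)

/-- The normal derivative at the endpoint `x`, in terms of the derivative `d` there: it is taken
in the direction into the edge. -/
def normalDeriv (x : E × Bool) (d : ℂ) : ℂ := if x.2 then -d else d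

/-- The `δ`-type matching conditions with coupling constants `α` for a function `u` with
derivative `u'`: `u` takes one value `val v` at all endpoints in the vertex `v`, and the normal
derivatives at these endpoints add up to `α v * val v`. -/
def DeltaMatching (α : V → ℝ) (u u' : G.L2) : Prop :=
  ∃ (val : V → ℂ) (d : E × Bool → ℂ),
    (∀ x : E × Bool, HasValueAt (u x.1) (G.position x) (val (G.vertexOf x))) ∧
    (∀ x : E × Bool, HasValueAt (u' x.1) (G.position x) (d x)) ∧
    ∀ v : V, ∑ x ∈ G.endpoints v, normalDeriv x (d x) = (α v : ℂ) * val v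

/-- The graph of the Laplacian with `δ`-type matching conditions: the pairs `(u, g)` such that
`u` has weak derivatives `u', u''` in `L₂(Γ)` on the edges (that is, `u` belongs to the Sobolev
space `W₂²` of every edge), satisfies the matching conditions at all vertices, and `g = -u''`. -/
def deltaLaplacianGraph (α : V → ℝ) : Submodule ℂ (G.L2 × G.L2) where
  carrier := {p | ∃ u' u'' : G.L2,
    (∀ e, HasWeakDeriv (p.1 e) (u' e)) ∧ (∀ e, HasWeakDeriv (u' e) (u'' e)) ∧
    G.DeltaMatching α p.1 u' ∧ p.2 = -u''}
  zero_mem' := by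
    refine ⟨0, 0, fun e => HasWeakDeriv.zero, fun e => HasWeakDeriv.zero,
      ⟨0, 0, fun x => HasValueAt.zero _, fun x => HasValueAt.zero _, fun v => ?_⟩, by simp⟩
    simp [normalDeriv]
  add_mem' := by
    rintro ⟨u, g⟩ ⟨w, k⟩ ⟨u', u'', h1, h2, ⟨a, d, h3, h4, h5⟩, h6⟩
      ⟨w', w'', k1, k2, ⟨b, f, k3, k4, k5⟩, k6⟩
    refine ⟨u' + w', u'' + w'', fun e => (h1 e).add (k1 e), fun e => (h2 e).add (k2 e),
      ⟨a + b, d + f, fun x => (h3 x).add (k3 x), fun x => (h4 x).add (k4 x), fun v => ?_⟩, ?_⟩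
    · have h : ∀ x, normalDeriv x ((d + f) x) = normalDeriv x (d x) + normalDeriv x (f x) := by
        intro x
        unfold normalDeriv
        split_ifs
        · simp only [Pi.add_apply]; ring
        · rfl
      rw [Finset.sum_congr rfl fun x _ => h x, Finset.sum_add_distrib, h5, k5, Pi.add_apply]
      ring
    · simp only at h6 k6
      simp only [Prod.snd_add, h6, k6]
      abel
  smul_mem' := by
    rintro c ⟨u, g⟩ ⟨u', u'', h1, h2, ⟨a, d, h3, h4, h5⟩, h6⟩
    refine ⟨c • u', c • u'', fun e => (h1 e).smul c, fun e => (h2 e).smul c,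
      ⟨fun v => c * a v, fun x => c * d x, fun x => (h3 x).smul c, fun x => (h4 x).smul c,
        fun v => ?_⟩, ?_⟩
    · have h : ∀ x, normalDeriv x (c * d x) = c * normalDeriv x (d x) := by
        intro x
        unfold normalDeriv
        split_ifs
        · ring
        · rfl
      simp only [h, ← Finset.mul_sum, h5]
      ring
    · simp only at h6
      simp [h6]

theorem deltaLaplacianGraph_single_valued (α : V → ℝ) :
    ∀ p ∈ G.deltaLaplacianGraph α, p.1 = 0 → p.2 = 0 := by
  rintro ⟨u, g⟩ ⟨u', u'', h1, h2, -, h6⟩ h0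
  simp only at h0 h1 h6
  have hu' : ∀ e, u' e = 0 := by
    intro e
    have h := h1 e
    rw [h0] at h
    exact HasWeakDeriv.eq_zero h
  have hu'' : ∀ e, u'' e = 0 := by
    intro e
    have h := h2 e
    rw [hu' e] at h
    exact HasWeakDeriv.eq_zero h
  have h7 : u'' = 0 := by
    ext1 e
    exact hu'' e
  simp [h6, h7]

/-- The graph Laplacian `-d²/dx²` in `L₂(Γ)` with `δ`-type matching conditions and coupling
constants `α`, an unbounded operator given by its graph. -/
def deltaLaplacian (α : V → ℝ) : G.L2 →ₗ.[ℂ] G.L2 :=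
  (G.deltaLaplacianGraph α).toLinearPMap

theorem graph_deltaLaplacian (α : V → ℝ) :
    (G.deltaLaplacian α).graph = G.deltaLaplacianGraph α :=
  Submodule.toLinearPMap_graph_eq _ (G.deltaLaplacianGraph_single_valued α)

end MetricGraph

/-- The eigenspace `ker (A - z)` of an unbounded operator `A`: all `u` in the domain of `A` with
`A u = z u`. -/
def eigenspace {H : Type*} [AddCommGroup H] [Module ℂ H] (A : H →ₗ.[ℂ] H) (z : ℂ) :
    Submodule ℂ H :=
  A.graph.comap (LinearMap.prod LinearMap.id (z • LinearMap.id))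

theorem mem_eigenspace {H : Type*} [AddCommGroup H] [Module ℂ H] {A : H →ₗ.[ℂ] H} {z : ℂ}
    {u : H} : u ∈ eigenspace A z ↔ ∃ h : u ∈ A.domain, A ⟨u, h⟩ = z • u := by
  simp [eigenspace, LinearPMap.mem_graph_iff]

/-- The point spectra of two operators agree, counting multiplicities: every complex number is an
eigenvalue of both with the same multiplicity (the dimension of the eigenspace, which is zero when
the number is not an eigenvalue). -/
def Isospectral {H : Type*} [AddCommGroup H] [Module ℂ H] (A₁ A₂ : H →ₗ.[ℂ] H) : Prop :=
  ∀ z : ℂ, Module.rank ℂ (eigenspace A₁ z) = Module.rank ℂ (eigenspace A₂ z)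

end QuantumGraph

end

/-! Compare the resolvents R₁ = (A_{B₁} + τ²)⁻¹ and R₂ = (A_{B₂} + τ²)⁻¹ for large τ > 0. Both are
injective, positive, compact and trace class. An eigenvalue z of the Laplacian becomes the
eigenvalue 1/(z + τ²) of its resolvent, so isospectrality gives Tr(R₁ - R₂) = 0
(`sum_inner_eq_zero_of_finrank_eigenspace_eq`). Compactness and summability of the eigenvalues both
come from one pointwise bound, τ|u(x)|² ≤ 4 Re⟨u, f⟩ for (A_B + τ²)u = f (`Represents.norm_sq_le`).

The difference R₁ - R₂ has finite rank. Let g_k be the edgewise solution of u'' = τ²u whose value is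
1 at the vertex k and 0 at the others, let Λ(τ) be the Dirichlet-to-Neumann matrix and M_B = B -
Λ(τ). Krein's formula (`resolvent_sub`) turns the vanishing trace into ∑_{k,l} (M_{B₁}⁻¹ -
M_{B₂}⁻¹)_{lk} ⟨g_k, g_l⟩ = 0.

As τ → ∞ the two ends of each edge decouple exponentially fast: Λ(τ) = -τΓ_N and ⟨g_k, g_l⟩ =
(Γ_N)_{kl}/(2τ), up to errors smaller than every power of 1/τ. The geometry of the graph disappears
except for the valences, and ∑_k [(τ + α̃_k/γ_k)⁻¹ - (τ + α_k/γ_k)⁻¹] decays faster than every power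
(`superpolynomialDecay_of_isospectral`). Its expansion in 1/τ shows that α̃_k/γ_k and α_k/γ_k have
the same power sums of every order (`sum_pow_eq_of_superpolynomialDecay`). For order m this is the
asserted identity, since (1/j)·C(m-1, m-j) = (1/m)·C(m, j) and the binomial theorem make its left
side (1/m)∑_k [(α̃_k/γ_k)^m - (α_k/γ_k)^m]. -/

/-! ### Compact operators and traces in Hilbert space. -/

open Module.End in
/-- Eigenvectors of a compact symmetric injective operator form a Hilbert basis. -/
theorem exists_hilbertBasis_eigenvectors {H : Type*} [NormedAddCommGroup H]
    [InnerProductSpace ℂ H] [CompleteSpace H] {T : H →L[ℂ] H} (hT : IsCompactOperator T)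
    (hs : (T : H →ₗ[ℂ] H).IsSymmetric) (h0 : eigenspace (T : H →ₗ[ℂ] H) 0 = ⊥) (d : ℂ → ℕ)
    (hd : ∀ μ, Module.finrank ℂ (eigenspace (T : H →ₗ[ℂ] H) μ) = d μ) :
    ∃ b : HilbertBasis (Σ μ, Fin (d μ)) ℂ H, ∀ i, T (b i) = i.1 • b i := by
  have hfin : ∀ μ, FiniteDimensional ℂ (eigenspace (T : H →ₗ[ℂ] H) μ) := by
    intro μ
    rcases eq_or_ne μ 0 with rfl | hμ
    · rw [h0]; infer_instance
    · exact ContinuousLinearMap.finite_dimensional_eigenspace hT μ hμ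
  let w : ∀ μ, OrthonormalBasis (Fin (d μ)) ℂ (eigenspace (T : H →ₗ[ℂ] H) μ) := fun μ =>
    (stdOrthonormalBasis ℂ _).reindex (finCongr (hd μ))
  have ho : Orthonormal ℂ fun a : Σ μ, Fin (d μ) => ((w a.1 a.2 : eigenspace _ a.1) : H) :=
    hs.orthogonalFamily_eigenspaces.orthonormal_sigma_orthonormal
      (v_family := fun μ => w μ) fun μ => (w μ).orthonormal
  have hsp : (Submodule.span ℂ (Set.range fun a : Σ μ, Fin (d μ) =>
      ((w a.1 a.2 : eigenspace _ a.1) : H)))ᗮ = ⊥ := by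
    -- By the spectral theorem it suffices that the span of the chosen vectors contains every
    -- eigenspace.
    rw [← le_bot_iff, ← ContinuousLinearMap.orthogonalComplement_iSup_eigenspaces_eq_bot hT hs]
    refine Submodule.orthogonal_le (iSup_le fun μ x hx => ?_)
    have hx2 : (x : H) = ∑ i, (w μ).repr ⟨x, hx⟩ i • (w μ i : H) := by
      have := congrArg Subtype.val ((w μ).sum_repr ⟨x, hx⟩)
      simpa using this.symm
    rw [hx2]
    exact Submodule.sum_mem _ fun i _ => Submodule.smul_mem _ _
      (Submodule.subset_span ⟨⟨μ, i⟩, rfl⟩)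
  refine ⟨HilbertBasis.mkOfOrthogonalEqBot ho hsp, fun i => ?_⟩
  rw [HilbertBasis.coe_mkOfOrthogonalEqBot]
  exact mem_eigenspace_iff.1 (w i.1 i.2).2

/-- Operators with bounded Hilbert–Schmidt sums are compact. -/
theorem isCompactOperator_of_sum_norm_sq_le {H : Type*} [NormedAddCommGroup H]
    [InnerProductSpace ℂ H] [CompleteSpace H] {T : H →L[ℂ] H} (C : ℝ)
    (hC : ∀ (w : Set H) (_ : Orthonormal ℂ ((↑) : w → H)) (s : Finset w),
      ∑ i ∈ s, ‖T i‖ ^ 2 ≤ C) : IsCompactOperator T := by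
  obtain ⟨w, b, hb⟩ := exists_hilbertBasis ℂ H
  have hbo : Orthonormal ℂ ((↑) : w → H) := hb ▸ b.orthonormal
  have hbi : ∀ i, b i = i := fun i => congrFun hb i
  have hsum : Summable fun i => ‖T (b i)‖ ^ 2 := by
    refine summable_of_sum_le (c := C) (fun i => by positivity) fun s => ?_
    simpa only [hbi] using hC w hbo s
  have hcl := isClosed_setOfPred_isCompactOperator (𝕜₁ := ℂ) (𝕜₂ := ℂ) (σ₁₂ := RingHom.id ℂ)
    (M₁ := H) (M₂ := H)
  refine hcl.closure_subset (Metric.mem_closure_iff.2 fun ε hε => ?_)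
  obtain ⟨s, hs⟩ := summable_iff_vanishing_norm.1 hsum ((ε / 2) ^ 2) (by positivity)
  -- `S` is `T` composed with the projection onto finitely many basis vectors. By Cauchy–Schwarz the
  -- error is controlled by the tail of the Hilbert–Schmidt sum, so `T` is a norm limit of finite
  -- rank operators.
  let S : H →L[ℂ] H := ∑ i ∈ s, (innerSL ℂ (b i)).smulRight (T (b i))
  refine ⟨S, ?_, ?_⟩
  · have : ∀ t : Finset w, IsCompactOperator
        (∑ i ∈ t, (innerSL ℂ (b i)).smulRight (T (b i)) : H →L[ℂ] H) := by
      intro t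
      induction t using Finset.cons_induction with
      | empty => simpa using isCompactOperator_zero (M₁ := H) (M₂ := H)
      | cons i t hi ih =>
        rw [Finset.sum_cons]
        refine IsCompactOperator.add (f := ((innerSL ℂ (b i)).smulRight (T (b i)) : H → H)) ?_ ih
        have h1 : IsCompactOperator (innerSL ℂ (b i) : H →L[ℂ] ℂ) :=
          isCompactOperator_of_locallyCompactSpace_dom (innerSL ℂ (b i) : H →L[ℂ] ℂ)
        exact h1.clm_comp ((1 : ℂ →L[ℂ] ℂ).smulRight (T (b i)))
    exact this s
  · rw [dist_eq_norm]
    refine lt_of_le_of_lt (ContinuousLinearMap.opNorm_le_bound _ (by positivity : 0 ≤ ε / 2)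
      fun x => ?_) (half_lt_self hε)
    have h1 : HasSum (fun i => b.repr x i • T (b i)) (T x) := by
      simpa using (b.hasSum_repr x).mapL T
    have h2 : Filter.Tendsto (fun t => ∑ i ∈ t, b.repr x i • T (b i) - S x) Filter.atTop
        (nhds (T x - S x)) := h1.sub_const _
    refine le_of_tendsto h2.norm ((Filter.eventually_ge_atTop s).mono fun t ht => ?_)
    classical
    have h3 : ∑ i ∈ t, b.repr x i • T (b i) - S x = ∑ i ∈ t \ s, b.repr x i • T (b i) := by
      rw [← Finset.sum_sdiff ht]
      simp [S, b.repr_apply_apply]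
    rw [h3]
    have h4 : ∑ i ∈ t \ s, ‖b.repr x i‖ ^ 2 ≤ ‖x‖ ^ 2 := by
      simpa only [b.repr_apply_apply] using b.orthonormal.sum_inner_products_le x
    have h5 : ∑ i ∈ t \ s, ‖T (b i)‖ ^ 2 ≤ (ε / 2) ^ 2 :=
      (le_abs_self _).trans (hs (t \ s) Finset.sdiff_disjoint).le
    refine abs_le_of_sq_le_sq' ?_ (by positivity) |>.2
    calc ‖∑ i ∈ t \ s, b.repr x i • T (b i)‖ ^ 2
        ≤ (∑ i ∈ t \ s, ‖b.repr x i‖ * ‖T (b i)‖) ^ 2 := by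
          gcongr
          refine (norm_sum_le _ _).trans (le_of_eq ?_)
          simp_rw [norm_smul]
      _ ≤ (∑ i ∈ t \ s, ‖b.repr x i‖ ^ 2) * ∑ i ∈ t \ s, ‖T (b i)‖ ^ 2 :=
          Finset.sum_mul_sq_le_sq_mul_sq _ _ _
      _ ≤ ‖x‖ ^ 2 * (ε / 2) ^ 2 := by gcongr
      _ = (ε / 2 * ‖x‖) ^ 2 := by ring

/-- If `T` is diagonal in a Hilbert basis with nonnegative summable eigenvalues, its trace can be
computed in any Hilbert basis. -/
theorem hasSum_inner_of_eigenbasis {H : Type*} [NormedAddCommGroup H]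
    [InnerProductSpace ℂ H] {ι κ : Type*} {T : H →L[ℂ] H}
    (b : HilbertBasis ι ℂ H) (c : HilbertBasis κ ℂ H) {l : ι → ℝ} (hl : ∀ i, 0 ≤ l i)
    (hT : ∀ i, T (b i) = (l i : ℂ) • b i) (hs : Summable l) :
    HasSum (fun n => inner ℂ (c n) (T (c n))) ((∑' i, l i : ℝ) : ℂ) := by
  have h1 : ∀ n, HasSum (fun i => ((l i * ‖inner ℂ (b i) (c n)‖ ^ 2 : ℝ) : ℂ))
      (inner ℂ (c n) (T (c n))) := by
    intro n
    have := ((b.hasSum_repr (c n)).mapL T).mapL (innerSL ℂ (c n))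
    convert! this using 2 with i
    simp only [map_smul, hT, b.repr_apply_apply, innerSL_apply_apply, smul_eq_mul]
    rw [← inner_conj_symm (c n) (b i), mul_left_comm, Complex.mul_conj']
    push_cast; ring
  have h2 : ∀ i, HasSum (fun n => l i * ‖inner ℂ (b i) (c n)‖ ^ 2) (l i) := by
    intro i
    have h3 := c.hasSum_inner_mul_inner (b i) (b i)
    rw [inner_self_eq_norm_sq_to_K, b.orthonormal.1 i] at h3
    have h4 : HasSum (fun n => ((‖inner ℂ (b i) (c n)‖ ^ 2 : ℝ) : ℂ)) ((1 : ℝ) : ℂ) := by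
      convert! h3 using 2 with n
      · rw [← inner_conj_symm (c n) (b i), Complex.mul_conj']; push_cast; rfl
      · simp
    simpa using (Complex.hasSum_ofReal.1 h4).mul_left (l i)
  -- The terms are nonnegative, so summability row by row (Parseval in `c`) makes the double sum
  -- absolutely convergent and allows the columns to be summed first.
  have h5 : Summable fun p : ι × κ => l p.1 * ‖inner ℂ (b p.1) (c p.2)‖ ^ 2 := by
    rw [summable_prod_of_nonneg fun p => mul_nonneg (hl _) (by positivity)]
    exact ⟨fun i => (h2 i).summable, by simpa only [(h2 _).tsum_eq] using hs⟩
  have h6 : HasSum (fun p : κ × ι => l p.2 * ‖inner ℂ (b p.2) (c p.1)‖ ^ 2) (∑' i, l i) := by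
    have := h5.hasSum
    rw [h5.tsum_prod' fun i => (h2 i).summable] at this
    simp only [(h2 _).tsum_eq] at this
    exact (Equiv.prodComm κ ι).hasSum_iff.2 this
  exact (Complex.hasSum_ofReal.2 h6).prod_fiberwise h1

/-- Two trace class operators with the same eigenvalues whose difference has finite rank: the
trace of the difference vanishes. -/
theorem sum_inner_eq_zero_of_finrank_eigenspace_eq {H : Type*} [NormedAddCommGroup H]
    [InnerProductSpace ℂ H] [CompleteSpace H] {T₁ T₂ : H →L[ℂ] H}
    (hc₁ : IsCompactOperator T₁) (hc₂ : IsCompactOperator T₂)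
    (hs₁ : (T₁ : H →ₗ[ℂ] H).IsSymmetric) (hs₂ : (T₂ : H →ₗ[ℂ] H).IsSymmetric)
    (hi₁ : Module.End.eigenspace (T₁ : H →ₗ[ℂ] H) 0 = ⊥)
    (hi₂ : Module.End.eigenspace (T₂ : H →ₗ[ℂ] H) 0 = ⊥)
    (hfr : ∀ μ, Module.finrank ℂ (Module.End.eigenspace (T₁ : H →ₗ[ℂ] H) μ) =
      Module.finrank ℂ (Module.End.eigenspace (T₂ : H →ₗ[ℂ] H) μ))
    (hp : ∀ f, 0 ≤ (inner ℂ f (T₁ f)).re) (C : ℝ)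
    (hC : ∀ (ι : Type) (s : Finset ι) (e : ι → H) (l : ι → ℝ), Orthonormal ℂ e →
      (∀ i, 0 < l i) → (∀ i, T₁ (e i) = (l i : ℂ) • e i) → ∑ i ∈ s, l i ≤ C)
    {κ : Type*} [Fintype κ] (φ ψ : κ → H)
    (hK : ∀ f, T₁ f - T₂ f = ∑ k, inner ℂ (ψ k) f • φ k) :
    ∑ k, inner ℂ (ψ k) (φ k) = 0 := by
  -- Both bases are indexed by the multiplicities of `T₂`, so they share index set and eigenvalues.
  -- Hence positivity and summability of the eigenvalues need to be known for `T₁` only.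
  obtain ⟨b₁, hb₁⟩ := exists_hilbertBasis_eigenvectors hc₁ hs₁ hi₁ _ fun μ => hfr μ
  obtain ⟨b₂, hb₂⟩ := exists_hilbertBasis_eigenvectors hc₂ hs₂ hi₂ _ fun μ => rfl
  have hval : ∀ i : (Σ μ, Fin (Module.finrank ℂ (Module.End.eigenspace (T₂ : H →ₗ[ℂ] H) μ))),
      ((i.1.re : ℝ) : ℂ) = i.1 ∧ 0 < i.1.re := by
    intro i
    have hn : inner ℂ (b₁ i) (b₁ i) = 1 := by
      rw [inner_self_eq_norm_sq_to_K, b₁.orthonormal.1 i]; simp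
    have h1 := hs₁ (b₁ i) (b₁ i)
    have h2 := hp (b₁ i)
    simp only [ContinuousLinearMap.coe_coe, hb₁, inner_smul_left, inner_smul_right, hn,
      mul_one] at h1 h2
    have h3 := Complex.conj_eq_iff_re.1 h1
    refine ⟨h3, lt_of_le_of_ne h2 fun h => ?_⟩
    have h4 : i.1 = 0 := by rw [← h3, ← h]; simp
    have h5 : b₁ i ∈ Module.End.eigenspace (T₁ : H →ₗ[ℂ] H) 0 := by
      rw [Module.End.mem_eigenspace_iff, ContinuousLinearMap.coe_coe, hb₁, h4]
    rw [hi₁, Submodule.mem_bot] at h5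
    exact b₁.orthonormal.ne_zero i h5
  have hb₁' : ∀ i, T₁ (b₁ i) = ((i.1.re : ℝ) : ℂ) • b₁ i := fun i => by rw [(hval i).1, hb₁]
  have hb₂' : ∀ i, T₂ (b₂ i) = ((i.1.re : ℝ) : ℂ) • b₂ i := fun i => by rw [(hval i).1, hb₂]
  have hsum := summable_of_sum_le (fun i => (hval i).2.le) fun s =>
    hC _ s b₁ _ b₁.orthonormal (fun i => (hval i).2) hb₁'
  -- Both traces are evaluated in the one basis `b₂`, which allows them to be subtracted term by
  -- term.
  have h1 := hasSum_inner_of_eigenbasis b₁ b₂ (fun i => (hval i).2.le) hb₁' hsum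
  have h2 := hasSum_inner_of_eigenbasis b₂ b₂ (fun i => (hval i).2.le) hb₂' hsum
  have h3 := h1.sub h2
  rw [sub_self] at h3
  refine HasSum.unique ?_ h3
  have h4 : HasSum (fun n => ∑ k, inner ℂ (ψ k) (b₂ n) * inner ℂ (b₂ n) (φ k))
      (∑ k, inner ℂ (ψ k) (φ k)) :=
    hasSum_sum fun k _ => b₂.hasSum_inner_mul_inner (ψ k) (φ k)
  convert! h4 using 2 with n
  rw [← inner_sub_right, hK, inner_sum]
  simp only [inner_smul_right]

/-! ### Weak derivatives on an edge and their classical representatives. -/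

namespace QuantumGraph

/-- Integration by parts for a primitive of an integrable function and a `C¹` function. -/
theorem integral_mul_eq_sub_of_primitive {a b : ℝ} (hab : a ≤ b) {g φ φ' : ℝ → ℂ} (c : ℂ)
    (hg : IntegrableOn g (Set.Icc a b)) (hφ : ∀ x, HasDerivAt φ (φ' x) x)
    (hφ' : Continuous φ') :
    ∫ x in a..b, g x * φ x = (c + ∫ x in a..b, g x) * φ b - c * φ a -
      ∫ x in a..b, (c + ∫ y in a..x, g y) * φ' x := by
  have hφc : Continuous φ := continuous_iff_continuousAt.2 fun x => (hφ x).continuousAt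
  have hgi : IntegrableOn g (Set.Ioc a b) := hg.mono_set Set.Ioc_subset_Icc_self
  have hgI : IntervalIntegrable g volume a b := (intervalIntegrable_iff_integrableOn_Ioc_of_le hab).2 hgi
  have hφI : ∀ x y : ℝ, IntervalIntegrable φ' volume x y := fun x y => hφ'.intervalIntegrable x y
  have hftc : ∀ x y : ℝ, ∫ t in x..y, φ' t = φ y - φ x := fun x y =>
    intervalIntegral.integral_eq_sub_of_hasDerivAt (fun t _ => hφ t) (hφI x y)
  have hφi : IntegrableOn φ' (Set.Ioc a b) := hφ'.integrableOn_Ioc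
  have hprod : Integrable (fun p : ℝ × ℝ => g p.1 * φ' p.2)
      ((volume.restrict (Set.Ioc a b)).prod (volume.restrict (Set.Ioc a b))) := hgi.mul_prod hφi
  have hmeas : MeasurableSet {p : ℝ × ℝ | p.1 < p.2} := measurableSet_lt measurable_fst measurable_snd
  -- Fubini for g(x)φ'(y) on the triangle x < y; since g is merely integrable, its primitive is not
  -- differentiated.
  have hswap := integral_integral_swap (f := fun x y =>
    {p : ℝ × ℝ | p.1 < p.2}.indicator (fun p : ℝ × ℝ => g p.1 * φ' p.2) (x, y))
    (μ := volume.restrict (Set.Ioc a b)) (ν := volume.restrict (Set.Ioc a b))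
    (hprod.indicator hmeas)
  have h1 : ∫ x in Set.Ioc a b, ∫ y in Set.Ioc a b,
      {p : ℝ × ℝ | p.1 < p.2}.indicator (fun p : ℝ × ℝ => g p.1 * φ' p.2) (x, y) =
      ∫ x in a..b, g x * (φ b - φ x) := by
    rw [intervalIntegral.integral_of_le hab]
    refine setIntegral_congr_fun measurableSet_Ioc fun x hx => ?_
    have : ∀ y, {p : ℝ × ℝ | p.1 < p.2}.indicator (fun p : ℝ × ℝ => g p.1 * φ' p.2) (x, y) =
        (Set.Ioi x).indicator (fun y => g x * φ' y) y := fun y => rfl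
    simp only [this]
    rw [setIntegral_indicator measurableSet_Ioi, Set.Ioc_inter_Ioi, sup_eq_right.2 hx.1.le,
      ← intervalIntegral.integral_of_le hx.2, intervalIntegral.integral_const_mul, hftc]
  have h2 : ∫ y in Set.Ioc a b, ∫ x in Set.Ioc a b,
      {p : ℝ × ℝ | p.1 < p.2}.indicator (fun p : ℝ × ℝ => g p.1 * φ' p.2) (x, y) =
      ∫ y in a..b, (∫ x in a..y, g x) * φ' y := by
    rw [intervalIntegral.integral_of_le hab]
    refine setIntegral_congr_fun measurableSet_Ioc fun y hy => ?_
    have : ∀ x, {p : ℝ × ℝ | p.1 < p.2}.indicator (fun p : ℝ × ℝ => g p.1 * φ' p.2) (x, y) =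
        (Set.Iio y).indicator (fun x => g x * φ' y) x := fun x => rfl
    simp only [this]
    have hset : Set.Ioc a b ∩ Set.Iio y = Set.Ioo a y := by
      ext x
      exact ⟨fun h => ⟨h.1.1, h.2⟩, fun h => ⟨⟨h.1, h.2.le.trans hy.2⟩, h.2⟩⟩
    rw [setIntegral_indicator measurableSet_Iio, hset, ← integral_Ioc_eq_integral_Ioo,
      ← intervalIntegral.integral_of_le hy.1.le, intervalIntegral.integral_mul_const]
  rw [h1, h2] at hswap
  have hc : Continuous fun y => ∫ x in a..y, φ' x := by
    exact intervalIntegral.continuous_primitive (fun _ _ => hφI _ _) _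
  have hcg : ContinuousOn (fun y => ∫ x in a..y, g x) (Set.uIcc a b) := by
    exact intervalIntegral.continuousOn_primitive_interval (by rwa [Set.uIcc_of_le hab])
  have hgφ : IntervalIntegrable (fun x => g x * φ x) volume a b :=
    hgI.mul_continuousOn hφc.continuousOn
  have e1 : ∫ x in a..b, g x * (φ b - φ x) = (∫ x in a..b, g x) * φ b - ∫ x in a..b, g x * φ x := by
    simp only [mul_sub]
    rw [intervalIntegral.integral_sub (hgI.mul_const _) hgφ, intervalIntegral.integral_mul_const]
  have e2 : ∫ x in a..b, (c + ∫ y in a..x, g y) * φ' x =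
      c * (φ b - φ a) + ∫ x in a..b, (∫ y in a..x, g y) * φ' x := by
    simp only [add_mul]
    rw [intervalIntegral.integral_add ((hφI a b).const_mul c)
      ((hφI a b).continuousOn_mul hcg), intervalIntegral.integral_const_mul, hftc]
  rw [e2, ← hswap, e1]
  ring

/-- The element of `L₂` of an interval given by a continuous function. -/
noncomputable def ofContinuous (a b : ℝ) (f : ℝ → ℂ) (hf : Continuous f) : EdgeL2 a b :=
  MemLp.toLp f (by
    obtain ⟨C, hC⟩ := isCompact_Icc.exists_bound_of_continuousOn (hf.continuousOn (s := Set.Icc a b))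
    refine MemLp.of_bound hf.aestronglyMeasurable C ?_
    exact (ae_restrict_iff' measurableSet_Icc).2 (Filter.Eventually.of_forall hC))

theorem coeFn_ofContinuous {a b : ℝ} {f : ℝ → ℂ} (hf : Continuous f) :
    ∀ᵐ x ∂(volume.restrict (Set.Icc a b)), ofContinuous a b f hf x = f x :=
  MemLp.coeFn_toLp _

theorem EdgeL2.integrableOn {a b : ℝ} (u : EdgeL2 a b) :
    IntegrableOn (fun x => u x) (Set.Icc a b) := u.integrable

theorem setIntegral_Icc_eq_intervalIntegral {a b : ℝ} (hab : a ≤ b) (f : ℝ → ℂ) :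
    ∫ x in Set.Icc a b, f x = ∫ x in a..b, f x := by
  rw [integral_Icc_eq_integral_Ioc, intervalIntegral.integral_of_le hab]

theorem eqOn_of_ae_eq {a b : ℝ} (hab : a < b) {f g : ℝ → ℂ} (hf : ContinuousOn f (Set.Icc a b))
    (hg : ContinuousOn g (Set.Icc a b))
    (h : ∀ᵐ x ∂(volume.restrict (Set.Icc a b)), f x = g x) : Set.EqOn f g (Set.Icc a b) :=
  Measure.eqOn_Icc_of_ae_eq _ hab.ne h hf hg

/-- Continuous functions that agree almost everywhere on a nondegenerate interval agree on all of
it, endpoints included, so boundary values do not depend on the representative. -/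
theorem hasValueAt_iff {a b : ℝ} (hab : a < b) {u : EdgeL2 a b} {f : ℝ → ℂ}
    (hf : ContinuousOn f (Set.Icc a b)) (hu : ∀ᵐ x ∂(volume.restrict (Set.Icc a b)), u x = f x)
    {x : ℝ} (hx : x ∈ Set.Icc a b) {c : ℂ} : HasValueAt u x c ↔ c = f x := by
  refine ⟨?_, fun h => ⟨f, hf, hu, h.symm⟩⟩
  rintro ⟨g, hg, hug, rfl⟩
  refine eqOn_of_ae_eq hab hg hf ?_ hx
  filter_upwards [hu, hug] with y h1 h2
  rw [← h1, h2]

/-- A primitive of an `L₂` function has this function as weak derivative. -/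
theorem hasWeakDeriv_of_primitive {a b : ℝ} (hab : a ≤ b) {u v : EdgeL2 a b} (c : ℂ)
    (hu : ∀ᵐ x ∂(volume.restrict (Set.Icc a b)), u x = c + ∫ y in a..x, v y) :
    HasWeakDeriv u v := by
  intro φ hs hc ht
  have ha : φ a = 0 := by
    by_contra h
    exact lt_irrefl _ (ht (subset_tsupport _ h)).1
  have hb : φ b = 0 := by
    by_contra h
    exact lt_irrefl _ (ht (subset_tsupport _ h)).2
  have hd : ∀ x, HasDerivAt (fun x => (φ x : ℂ)) ((deriv φ x : ℝ) : ℂ) x := fun x =>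
    ((hs.differentiable (by simp)).differentiableAt.hasDerivAt).ofReal_comp
  have hp := integral_mul_eq_sub_of_primitive hab c v.integrableOn hd
    (Complex.continuous_ofReal.comp (hs.continuous_deriv (by simp)))
  simp only [ha, hb, Complex.ofReal_zero, mul_zero, zero_sub, sub_zero] at hp
  have h1 : ∫ x in Set.Icc a b, deriv φ x • u x =
      ∫ x in a..b, (c + ∫ y in a..x, v y) * ((deriv φ x : ℝ) : ℂ) := by
    rw [← setIntegral_Icc_eq_intervalIntegral hab]
    refine integral_congr_ae ?_
    filter_upwards [hu] with x hx
    rw [hx, Complex.real_smul, mul_comm]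
  have h2 : ∫ x in Set.Icc a b, φ x • v x = ∫ x in a..b, v x * (φ x : ℂ) := by
    rw [← setIntegral_Icc_eq_intervalIntegral hab]
    simp only [Complex.real_smul, mul_comm]
  rw [h1, h2, hp, neg_neg]

/-- The primitive of a smooth function with zero integral supported in `[p, q]`. -/
theorem exists_primitive_of_integral_eq_zero {a b : ℝ} {ψ : ℝ → ℝ} (hs : ContDiff ℝ ∞ ψ)
    (hc : HasCompactSupport ψ) (ht : tsupport ψ ⊆ Set.Ioo a b) (h0 : ∫ x in a..b, ψ x = 0) :
    ∃ Φ : ℝ → ℝ, ContDiff ℝ ∞ Φ ∧ HasCompactSupport Φ ∧ tsupport Φ ⊆ Set.Ioo a b ∧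
      deriv Φ = ψ := by
  have hd : ∀ x, HasDerivAt (fun x => ∫ y in a..x, ψ y) (ψ x) x := fun x =>
    intervalIntegral.integral_hasDerivAt_right (hs.continuous.intervalIntegrable _ _)
      hs.continuous.stronglyMeasurable.stronglyMeasurableAtFilter hs.continuous.continuousAt
  have hd' : deriv (fun x => ∫ y in a..x, ψ y) = ψ := funext fun x => (hd x).deriv
  -- If the support is empty, `p = 1` and `q = 0` give an empty interval.
  obtain ⟨p, q, hpq, hsub⟩ : ∃ p q : ℝ, (∀ x ∈ Set.Icc p q, x ∈ Set.Ioo a b) ∧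
      tsupport ψ ⊆ Set.Icc p q := by
    rcases (tsupport ψ).eq_empty_or_nonempty with he | hne
    · exact ⟨1, 0, by simp, by simp [he]⟩
    · have hk : IsCompact (tsupport ψ) := hc
      refine ⟨sInf (tsupport ψ), sSup (tsupport ψ), fun x hx => ?_, fun x hx =>
        ⟨csInf_le hk.bddBelow hx, le_csSup hk.bddAbove hx⟩⟩
      exact ⟨(ht (hk.sInf_mem hne)).1.trans_le hx.1, hx.2.trans_lt (ht (hk.sSup_mem hne)).2⟩
  have hz : ∀ x, x ∉ Set.Icc p q → ψ x = 0 := fun x hx => by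
    by_contra h
    exact hx (hsub (subset_tsupport _ h))
  have hΦ : ∀ x, x ∉ Set.Icc p q → ∫ y in a..x, ψ y = 0 := by
    intro x hx
    have hzero : ∀ s t : ℝ, (∀ y ∈ Set.uIcc s t, y ∉ Set.Icc p q) → ∫ y in s..t, ψ y = 0 := by
      intro s t hst
      rw [intervalIntegral.integral_congr (g := fun _ => 0) fun y hy => hz y (hst y hy)]
      simp
    by_cases hpq' : p ≤ q
    · have hp := hpq p ⟨le_rfl, hpq'⟩
      have hq := hpq q ⟨hpq', le_rfl⟩
      by_cases hxp : x < p
      · exact hzero _ _ fun y hy h => not_lt.2 h.1 (hy.2.trans_lt (max_lt hp.1 hxp))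
      -- To the right of `q` the integral up to `b` is the total integral, which is zero, and
      -- between `b` and `x` the integrand vanishes.
      · have hxq : q < x := not_le.1 fun h => hx ⟨not_lt.1 hxp, h⟩
        have := intervalIntegral.integral_add_adjacent_intervals
          (hs.continuous.intervalIntegrable (μ := volume) a b)
          (hs.continuous.intervalIntegrable b x)
        rw [← this, h0, zero_add]
        exact hzero _ _ fun y hy h => not_lt.2 h.2 ((lt_min hq.2 hxq).trans_le hy.1)
    · exact hzero _ _ fun y _ h => hpq' (h.1.trans h.2)
  have hsupp : tsupport (fun x => ∫ y in a..x, ψ y) ⊆ Set.Icc p q :=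
    closure_minimal (fun x hx => by_contra fun h => hx (hΦ x h)) isClosed_Icc
  refine ⟨_, ?_, HasCompactSupport.of_support_subset_isCompact isCompact_Icc
    ((subset_tsupport _).trans hsupp), fun x hx => hpq x (hsupp hx), hd'⟩
  have : ContDiff ℝ (∞ + 1) (fun x => ∫ y in a..x, ψ y) := by
    rw [contDiff_succ_iff_deriv]
    refine ⟨fun x => (hd x).differentiableAt, by simp, by rwa [hd']⟩
  simpa using this

/-- A function with vanishing weak derivative is constant. -/
theorem HasWeakDeriv.ae_eq_const {a b : ℝ} (hab : a < b) {u : EdgeL2 a b}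
    (h : HasWeakDeriv u 0) :
    ∃ c : ℂ, ∀ᵐ x ∂(volume.restrict (Set.Icc a b)), u x = c := by
  -- A reference test function of integral one. Subtracting from `φ` its integral times this
  -- function leaves the derivative of a test function, which the hypothesis annihilates.
  let ρ : ContDiffBump ((a + b) / 2) := ⟨(b - a) / 8, (b - a) / 4, by linarith, by linarith⟩
  let ψ₀ : ℝ → ℝ := ρ.normed volume
  have hs₀ : ContDiff ℝ ∞ ψ₀ := ρ.contDiff_normed
  have hc₀ : HasCompactSupport ψ₀ := ρ.hasCompactSupport_normed
  have ht₀ : tsupport ψ₀ ⊆ Set.Ioo a b := by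
    rw [ρ.tsupport_normed_eq, Real.closedBall_eq_Icc]
    refine Set.Icc_subset_Ioo ?_ ?_ <;> simp only [ρ] <;> linarith
  have hint : ∀ φ : ℝ → ℝ, tsupport φ ⊆ Set.Ioo a b → ∫ x in a..b, φ x = ∫ x, φ x := by
    intro φ ht
    rw [intervalIntegral.integral_of_le hab.le, integral_Ioc_eq_integral_Ioo]
    exact setIntegral_eq_integral_of_forall_compl_eq_zero fun x hx => by
      by_contra h'
      exact hx (ht (subset_tsupport _ h'))
  have h1₀ : ∫ x in a..b, ψ₀ x = 1 := (hint ψ₀ ht₀).trans (ρ.integral_normed)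
  let c := ∫ x in Set.Icc a b, ψ₀ x • u x
  refine ⟨c, ?_⟩
  have hkey : ∀ φ : ℝ → ℝ, ContDiff ℝ ∞ φ → HasCompactSupport φ → tsupport φ ⊆ Set.Ioo a b →
      ∫ x in Set.Icc a b, φ x • (u x - c) = 0 := by
    intro φ hs hc ht
    let t := ∫ x in a..b, φ x
    have hts : tsupport (fun x => φ x - t * ψ₀ x) ⊆ Set.Ioo a b := by
      refine (tsupport_sub φ (fun x => t * ψ₀ x)).trans (Set.union_subset ht ?_)
      exact (tsupport_mul_subset_right (f := fun _ => t) (g := ψ₀)).trans ht₀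
    obtain ⟨Φ, hΦs, hΦc, hΦt, hΦ⟩ := exists_primitive_of_integral_eq_zero
      (ψ := fun x => φ x - t * ψ₀ x) (hs.sub (contDiff_const.mul hs₀))
      (hc.sub (hc₀.mul_left (f := fun _ => t))) hts (by
        rw [intervalIntegral.integral_sub (hs.continuous.intervalIntegrable _ _)
          ((hs₀.continuous.const_mul t).intervalIntegrable _ _),
          intervalIntegral.integral_const_mul, h1₀]
        simp [t])
    have h2 := h Φ hΦs hΦc hΦt
    have hz : ∫ x in Set.Icc a b, Φ x • (0 : EdgeL2 a b) x = 0 := by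
      apply integral_eq_zero_of_ae
      filter_upwards [Lp.coeFn_zero ℂ 2 (volume.restrict (Set.Icc a b))] with x hx
      rw [hx]
      simp
    rw [hz, hΦ, neg_zero] at h2
    have i1 := u.integrable_smul hs.continuous hc
    have i2 := u.integrable_smul hs₀.continuous hc₀
    have h3 : ∫ x in Set.Icc a b, φ x • u x = t * c := by
      have : ∀ x, (φ x - t * ψ₀ x) • u x = φ x • u x - (t : ℂ) * (ψ₀ x • u x) := fun x => by
        simp only [Complex.real_smul]; push_cast; ring
      simp only [this] at h2
      rw [integral_sub i1 (i2.const_mul _), integral_const_mul] at h2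
      exact sub_eq_zero.1 h2
    simp only [smul_sub]
    rw [integral_sub i1 ((hs.continuous.integrableOn_Icc).smul_const c), h3, integral_smul_const,
      integral_Icc_eq_integral_Ioc, ← intervalIntegral.integral_of_le hab.le, Complex.real_smul]
    exact sub_self _
  have h3 := isOpen_Ioo.ae_eq_zero_of_integral_contDiff_smul_eq_zero
    (U := Set.Ioo a b) (μ := volume.restrict (Set.Icc a b)) (f := fun x => u x - c)
    ((u.integrable.sub (integrable_const c)).locallyIntegrable.locallyIntegrableOn _) hkey
  have h4 : ∀ᵐ x ∂(volume.restrict (Set.Icc a b)), x ∈ Set.Ioo a b := by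
    rw [← restrict_Ioo_eq_restrict_Icc]
    exact ae_restrict_mem measurableSet_Ioo
  filter_upwards [h3, h4] with x hx hx'
  exact sub_eq_zero.1 (hx hx')

/-- The extension of an `L₂` function on an interval by zero. -/
noncomputable def EdgeL2.extend {a b : ℝ} (u : EdgeL2 a b) : ℝ → ℂ :=
  (Set.Icc a b).indicator fun x => u x

theorem EdgeL2.integrable_extend {a b : ℝ} (u : EdgeL2 a b) : Integrable u.extend :=
  u.integrableOn.integrable_indicator measurableSet_Icc

theorem EdgeL2.continuous_primitive {a b : ℝ} (u : EdgeL2 a b) :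
    Continuous fun x => ∫ y in a..x, u.extend y :=
  intervalIntegral.continuous_primitive (fun _ _ => u.integrable_extend.intervalIntegrable) _

theorem EdgeL2.integral_extend {a b : ℝ} (u : EdgeL2 a b) {x : ℝ} (hx : x ∈ Set.Icc a b) :
    ∫ y in a..x, u.extend y = ∫ y in a..x, u y := by
  refine intervalIntegral.integral_congr fun y hy => ?_
  rw [Set.uIcc_of_le hx.1] at hy
  exact Set.indicator_of_mem (show y ∈ Set.Icc a b from ⟨hy.1, hy.2.trans hx.2⟩) _

/-- A function with an `L₂` weak derivative is the primitive of this derivative. -/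
theorem HasWeakDeriv.exists_primitive {a b : ℝ} (hab : a < b) {u v : EdgeL2 a b}
    (h : HasWeakDeriv u v) :
    ∃ c : ℂ, ∀ᵐ x ∂(volume.restrict (Set.Icc a b)), u x = c + ∫ y in a..x, v y := by
  have hcont := v.continuous_primitive
  have hmem : ∀ᵐ x ∂(volume.restrict (Set.Icc a b)), x ∈ Set.Icc a b :=
    ae_restrict_mem measurableSet_Icc
  have h1 : ∀ᵐ x ∂(volume.restrict (Set.Icc a b)),
      ofContinuous a b _ hcont x = 0 + ∫ y in a..x, v y := by
    filter_upwards [coeFn_ofContinuous hcont, hmem] with x hx hx'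
    rw [hx, v.integral_extend hx', zero_add]
  -- `u` minus the primitive of `v` has weak derivative zero, hence is constant.
  have h2 := h.add ((hasWeakDeriv_of_primitive hab.le 0 h1).smul (-1))
  rw [show v + (-1 : ℂ) • v = 0 by simp] at h2
  obtain ⟨c, hc⟩ := h2.ae_eq_const hab
  refine ⟨c, ?_⟩
  filter_upwards [hc, h1, Lp.coeFn_add u ((-1 : ℂ) • ofContinuous a b _ hcont),
    Lp.coeFn_smul (-1 : ℂ) (ofContinuous a b _ hcont)] with x e1 e2 e3 e4
  rw [e3, Pi.add_apply, e4, Pi.smul_apply, e2] at e1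
  rw [← e1]
  simp

/-- `U` is the twice weakly differentiable representative of `u`, with derivative `U'` and second
weak derivative `g`. -/
structure IsRegular {a b : ℝ} (u g : EdgeL2 a b) (U U' : ℝ → ℂ) : Prop where
  ae_eq : ∀ᵐ x ∂(volume.restrict (Set.Icc a b)), u x = U x
  hasDerivAt : ∀ x, HasDerivAt U (U' x) x
  continuous_deriv : Continuous U'
  deriv_eq : ∀ x ∈ Set.Icc a b, U' x = U' a + ∫ y in a..x, g y

theorem IsRegular.continuous {a b : ℝ} {u g : EdgeL2 a b} {U U' : ℝ → ℂ}
    (h : IsRegular u g U U') : Continuous U :=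
  continuous_iff_continuousAt.2 fun x => (h.hasDerivAt x).continuousAt

/-- The representative is a double primitive of `g` extended by zero. It is therefore C¹ on the
whole line, and no one-sided derivatives occur at the endpoints. -/
theorem exists_isRegular {a b : ℝ} (hab : a < b) {u u' g : EdgeL2 a b}
    (h₁ : HasWeakDeriv u u') (h₂ : HasWeakDeriv u' g) :
    ∃ U U', IsRegular u g U U' ∧ ∀ᵐ x ∂(volume.restrict (Set.Icc a b)), u' x = U' x := by
  obtain ⟨c, hc⟩ := h₁.exists_primitive hab
  obtain ⟨d, hd⟩ := h₂.exists_primitive hab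
  have hmem : ∀ᵐ x ∂(volume.restrict (Set.Icc a b)), x ∈ Set.Icc a b :=
    ae_restrict_mem measurableSet_Icc
  let U' : ℝ → ℂ := fun x => d + ∫ y in a..x, g.extend y
  have hU' : Continuous U' := continuous_const.add g.continuous_primitive
  have hae : ∀ᵐ x ∂(volume.restrict (Set.Icc a b)), u' x = U' x := by
    filter_upwards [hd, hmem] with x hx hx'
    rw [hx, ← g.integral_extend hx']
  refine ⟨fun x => c + ∫ y in a..x, U' y, U', ⟨?_, fun x => ?_, hU', fun x hx => ?_⟩, hae⟩
  · filter_upwards [hc, hmem] with x hx hx'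
    rw [hx]
    congr 1
    refine intervalIntegral.integral_congr_ae ?_
    rw [ae_restrict_iff' measurableSet_Icc] at hae
    filter_upwards [hae] with y hy hy'
    rw [Set.uIoc_of_le hx'.1] at hy'
    exact hy ⟨hy'.1.le, hy'.2.trans hx'.2⟩
  · exact (intervalIntegral.integral_hasDerivAt_right (hU'.intervalIntegrable _ _)
      hU'.stronglyMeasurable.stronglyMeasurableAtFilter hU'.continuousAt).const_add c
  · simp only [U', intervalIntegral.integral_same, add_zero, g.integral_extend hx]

theorem IsRegular.hasWeakDeriv {a b : ℝ} (hab : a ≤ b) {u g : EdgeL2 a b} {U U' : ℝ → ℂ}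
    (h : IsRegular u g U U') :
    HasWeakDeriv u (ofContinuous a b U' h.continuous_deriv) ∧
      HasWeakDeriv (ofContinuous a b U' h.continuous_deriv) g := by
  have hmem : ∀ᵐ x ∂(volume.restrict (Set.Icc a b)), x ∈ Set.Icc a b :=
    ae_restrict_mem measurableSet_Icc
  constructor
  · refine hasWeakDeriv_of_primitive hab (U a) ?_
    filter_upwards [h.ae_eq, hmem] with x hx hx'
    have hI : ∫ y in a..x, ofContinuous a b U' h.continuous_deriv y = ∫ y in a..x, U' y := by
      refine intervalIntegral.integral_congr_ae ?_
      have := coeFn_ofContinuous (a := a) (b := b) h.continuous_deriv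
      rw [ae_restrict_iff' measurableSet_Icc] at this
      filter_upwards [this] with y hy hy'
      rw [Set.uIoc_of_le hx'.1] at hy'
      exact hy ⟨hy'.1.le, hy'.2.trans hx'.2⟩
    rw [hx, hI, intervalIntegral.integral_eq_sub_of_hasDerivAt (fun y _ => h.hasDerivAt y)
      (h.continuous_deriv.intervalIntegrable _ _)]
    ring
  · refine hasWeakDeriv_of_primitive hab (U' a) ?_
    filter_upwards [coeFn_ofContinuous h.continuous_deriv, hmem] with x hx hx'
    rw [hx, h.deriv_eq x hx']

end QuantumGraph

/-! ### Energy form, hyperbolic solutions and the Dirichlet problem on an edge. -/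

namespace QuantumGraph

open ComplexConjugate

theorem IsRegular.add {a b : ℝ} {u g w k : EdgeL2 a b} {U U' W W' : ℝ → ℂ}
    (h : IsRegular u g U U') (h₁ : IsRegular w k W W') :
    IsRegular (u + w) (g + k) (fun x => U x + W x) (fun x => U' x + W' x) where
  ae_eq := by
    filter_upwards [h.ae_eq, h₁.ae_eq, Lp.coeFn_add u w] with x e1 e2 e3
    rw [e3, Pi.add_apply, e1, e2]
  hasDerivAt x := (h.hasDerivAt x).add (h₁.hasDerivAt x)
  continuous_deriv := h.continuous_deriv.add h₁.continuous_deriv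
  deriv_eq x hx := by
    have hi : ∀ v : EdgeL2 a b, IntervalIntegrable (fun y => v y) volume a x := fun v =>
      (intervalIntegrable_iff_integrableOn_Ioc_of_le hx.1).2
        (v.integrableOn.mono_set fun y hy => ⟨hy.1.le, hy.2.trans hx.2⟩)
    have : ∫ y in a..x, (g + k) y = (∫ y in a..x, g y) + ∫ y in a..x, k y := by
      rw [← intervalIntegral.integral_add (hi g) (hi k)]
      refine intervalIntegral.integral_congr_ae ?_
      have := Lp.coeFn_add g k
      rw [Filter.EventuallyEq, ae_restrict_iff' measurableSet_Icc] at this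
      filter_upwards [this] with y hy hy'
      rw [Set.uIoc_of_le hx.1] at hy'
      exact hy ⟨hy'.1.le, hy'.2.trans hx.2⟩
    rw [this, h.deriv_eq x hx, h₁.deriv_eq x hx]
    ring

theorem IsRegular.smul {a b : ℝ} {u g : EdgeL2 a b} {U U' : ℝ → ℂ} (c : ℂ)
    (h : IsRegular u g U U') :
    IsRegular (c • u) (c • g) (fun x => c * U x) (fun x => c * U' x) where
  ae_eq := by
    filter_upwards [h.ae_eq, Lp.coeFn_smul c u] with x e1 e3
    rw [e3, Pi.smul_apply, e1, smul_eq_mul]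
  hasDerivAt x := (h.hasDerivAt x).const_mul c
  continuous_deriv := continuous_const.mul h.continuous_deriv
  deriv_eq x hx := by
    have : ∫ y in a..x, (c • g) y = c * ∫ y in a..x, g y := by
      rw [← intervalIntegral.integral_const_mul]
      refine intervalIntegral.integral_congr_ae ?_
      have := Lp.coeFn_smul c g
      rw [Filter.EventuallyEq, ae_restrict_iff' measurableSet_Icc] at this
      filter_upwards [this] with y hy hy'
      rw [Set.uIoc_of_le hx.1] at hy'
      exact hy ⟨hy'.1.le, hy'.2.trans hx.2⟩
    rw [this, h.deriv_eq x hx]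
    ring

theorem IsRegular.of_hasDerivAt {a b : ℝ} {u g : EdgeL2 a b} {U U' U'' : ℝ → ℂ}
    (hu : ∀ᵐ x ∂(volume.restrict (Set.Icc a b)), u x = U x)
    (hg : ∀ᵐ x ∂(volume.restrict (Set.Icc a b)), g x = U'' x)
    (hU : ∀ x, HasDerivAt U (U' x) x) (hU' : ∀ x, HasDerivAt U' (U'' x) x)
    (hc : Continuous U'') : IsRegular u g U U' where
  ae_eq := hu
  hasDerivAt := hU
  continuous_deriv := continuous_iff_continuousAt.2 fun x => (hU' x).continuousAt
  deriv_eq x hx := by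
    have hI : ∫ y in a..x, g y = ∫ y in a..x, U'' y := by
      refine intervalIntegral.integral_congr_ae ?_
      rw [ae_restrict_iff' measurableSet_Icc] at hg
      filter_upwards [hg] with y hy hy'
      rw [Set.uIoc_of_le hx.1] at hy'
      exact hy ⟨hy'.1.le, hy'.2.trans hx.2⟩
    rw [hI, intervalIntegral.integral_eq_sub_of_hasDerivAt (fun y _ => hU' y)
      (hc.intervalIntegrable _ _)]
    ring

/-- The energy form `∫ (w̄' u' + τ² w̄ u)` on an edge. -/
noncomputable def energy (a b τ : ℝ) (W W' U U' : ℝ → ℂ) : ℂ :=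
  ∫ x in a..b, (conj (W' x) * U' x + (τ : ℂ) ^ 2 * (conj (W x) * U x))

/-- Green's first identity on one edge: one integration by parts moves a derivative onto the test
function, and the boundary terms will be collected into normal derivatives at the vertices. -/
theorem IsRegular.inner_eq {a b : ℝ} (hab : a ≤ b) {u g w k : EdgeL2 a b} {U U' W W' : ℝ → ℂ}
    (h₁ : IsRegular w k W W') (h : IsRegular u g U U') (τ : ℝ) :
    inner ℂ w (-g + ((τ : ℂ) ^ 2) • u) =
      energy a b τ W W' U U' + conj (W a) * U' a - conj (W b) * U' b := by
  have e1 : inner ℂ w u = ∫ x in a..b, conj (W x) * U x := by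
    rw [L2.inner_def, ← setIntegral_Icc_eq_intervalIntegral hab]
    refine integral_congr_ae ?_
    filter_upwards [h.ae_eq, h₁.ae_eq] with x hx hx₁
    rw [hx, hx₁, RCLike.inner_apply, mul_comm]
  have e2 : inner ℂ w g = conj (W b) * U' b - conj (W a) * U' a -
      ∫ x in a..b, conj (W' x) * U' x := by
    have hd : ∀ x, HasDerivAt (fun x => conj (W x)) (conj (W' x)) x := fun x =>
      (h₁.hasDerivAt x).star
    have := integral_mul_eq_sub_of_primitive hab (U' a) g.integrableOn hd
      (Complex.continuous_conj.comp h₁.continuous_deriv)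
    have e3 : ∫ x in a..b, (U' a + ∫ y in a..x, g y) * conj (W' x) =
        ∫ x in a..b, conj (W' x) * U' x := by
      refine intervalIntegral.integral_congr fun x hx => ?_
      rw [Set.uIcc_of_le hab] at hx
      simp only [← h.deriv_eq x hx, mul_comm]
    rw [e3, ← h.deriv_eq b ⟨hab, le_rfl⟩] at this
    have e4 : inner ℂ w g = ∫ x in a..b, g x * conj (W x) := by
      rw [L2.inner_def, ← setIntegral_Icc_eq_intervalIntegral hab]
      refine integral_congr_ae ?_
      filter_upwards [h₁.ae_eq] with x hx₁
      rw [hx₁, RCLike.inner_apply]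
    rw [e4, this]
    ring
  have c1 : Continuous fun x => conj (W' x) * U' x :=
    (Complex.continuous_conj.comp h₁.continuous_deriv).mul h.continuous_deriv
  have c2 : Continuous fun x => conj (W x) * U x :=
    (Complex.continuous_conj.comp h₁.continuous).mul h.continuous
  rw [inner_add_right, inner_neg_right, inner_smul_right, e1, e2, energy,
    intervalIntegral.integral_add (c1.intervalIntegrable _ _)
      ((c2.const_mul ((τ : ℂ) ^ 2)).intervalIntegrable _ _), intervalIntegral.integral_const_mul]
  ring

theorem energy_conj (a b τ : ℝ) (W W' U U' : ℝ → ℂ) :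
    conj (energy a b τ W W' U U') = energy a b τ U U' W W' := by
  rw [energy, energy, intervalIntegral, intervalIntegral, map_sub, ← integral_conj, ← integral_conj]
  simp only [map_add, map_mul, map_pow, Complex.conj_conj, Complex.conj_ofReal, mul_comm]

theorem energy_self (a b τ : ℝ) (U U' : ℝ → ℂ) :
    energy a b τ U U' U U' = ((∫ x in a..b, (‖U' x‖ ^ 2 + τ ^ 2 * ‖U x‖ ^ 2) : ℝ) : ℂ) := by
  rw [energy, ← intervalIntegral.integral_ofReal]
  refine intervalIntegral.integral_congr fun x _ => ?_
  simp only [Complex.conj_mul']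
  push_cast
  rfl

/-- Pointwise values are controlled by the energy. -/
theorem norm_sq_le_energy {a b τ : ℝ} (hab : a < b) (hτ : 1 ≤ τ * (b - a)) {U U' : ℝ → ℂ}
    (hU : ∀ x, HasDerivAt U (U' x) x) (hU' : Continuous U') {x : ℝ} (hx : x ∈ Set.Icc a b) :
    τ * ‖U x‖ ^ 2 ≤ 2 * ∫ y in a..b, (‖U' y‖ ^ 2 + τ ^ 2 * ‖U y‖ ^ 2) := by
  have hτ0 : 0 < τ := by
    by_contra h
    nlinarith
  have hUc : Continuous U := continuous_iff_continuousAt.2 fun x => (hU x).continuousAt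
  set e : ℝ → ℝ := fun y => ‖U' y‖ ^ 2 + τ ^ 2 * ‖U y‖ ^ 2 with he
  have hec : Continuous e := by fun_prop
  have he0 : ∀ y, 0 ≤ e y := fun y => by positivity
  set 𝓔 := ∫ y in a..b, e y
  have hd : ∀ y, HasDerivAt (fun y => ‖U y‖ ^ 2) (2 * inner ℝ (U y) (U' y)) y := fun y =>
    (hU y).norm_sq
  have hdc : Continuous fun y => 2 * inner ℝ (U y) (U' y) :=
    continuous_const.mul (hUc.inner hU')
  -- The inequality 2·|U'|·τ|U| ≤ |U'|² + τ²|U|² bounds the derivative of τ|U|² by the energy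
  -- density.
  have hbd : ∀ y, τ * |2 * inner ℝ (U y) (U' y)| ≤ e y := by
    intro y
    have h1 := abs_real_inner_le_norm (U y) (U' y)
    rw [abs_mul, abs_two]
    have h2 := mul_le_mul_of_nonneg_left h1 hτ0.le
    simp only [he]
    nlinarith [sq_nonneg (‖U' y‖ - τ * ‖U y‖)]
  have hdiff : ∀ y ∈ Set.Icc a b, τ * ‖U x‖ ^ 2 ≤ 𝓔 + τ * ‖U y‖ ^ 2 := by
    intro y hy
    have h1 : ‖U x‖ ^ 2 - ‖U y‖ ^ 2 = ∫ t in y..x, 2 * inner ℝ (U t) (U' t) :=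
      (intervalIntegral.integral_eq_sub_of_hasDerivAt (fun t _ => hd t)
        (hdc.intervalIntegrable _ _)).symm
    have h2 : |∫ t in y..x, 2 * inner ℝ (U t) (U' t)| ≤ ∫ t in a..b, |2 * inner ℝ (U t) (U' t)| := by
      have h3 := intervalIntegral.norm_integral_le_integral_norm_uIoc
        (f := fun t => 2 * inner ℝ (U t) (U' t)) (a := y) (b := x) (μ := volume)
      refine h3.trans ?_
      rw [intervalIntegral.integral_of_le hab.le]
      refine setIntegral_mono_set (hdc.norm.integrableOn_Ioc)
        (Filter.Eventually.of_forall fun t => abs_nonneg _) (Filter.Eventually.of_forall ?_)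
      exact Set.Ioc_subset_Ioc (le_min hy.1 hx.1) (max_le hy.2 hx.2)
    have h4 : τ * ∫ t in a..b, |2 * inner ℝ (U t) (U' t)| ≤ 𝓔 := by
      rw [← intervalIntegral.integral_const_mul]
      exact intervalIntegral.integral_mono_on hab.le
        ((continuous_const.mul hdc.abs).intervalIntegrable _ _) (hec.intervalIntegrable _ _)
        fun t _ => hbd t
    have h5 : ‖U x‖ ^ 2 - ‖U y‖ ^ 2 ≤ ∫ t in a..b, |2 * inner ℝ (U t) (U' t)| := by
      rw [h1]
      exact (le_abs_self _).trans h2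
    nlinarith [mul_le_mul_of_nonneg_left h5 hτ0.le]
  -- Average over the comparison point `y`. After multiplication by τ the last term costs at most 𝓔,
  -- and 𝓔 ≤ τ(b - a)𝓔 by `hτ`; this gives the factor 2.
  have hint : ∫ _ in a..b, τ * ‖U x‖ ^ 2 ≤ ∫ y in a..b, (𝓔 + τ * ‖U y‖ ^ 2) :=
    intervalIntegral.integral_mono_on hab.le (by simp)
      ((by fun_prop : Continuous fun y => 𝓔 + τ * ‖U y‖ ^ 2).intervalIntegrable _ _) hdiff
  rw [intervalIntegral.integral_add (by simp)
    ((by fun_prop : Continuous fun y => τ * ‖U y‖ ^ 2).intervalIntegrable _ _),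
    intervalIntegral.integral_const, intervalIntegral.integral_const, smul_eq_mul,
    smul_eq_mul] at hint
  have h6 : τ * ∫ y in a..b, τ * ‖U y‖ ^ 2 ≤ 𝓔 := by
    rw [← intervalIntegral.integral_const_mul]
    refine intervalIntegral.integral_mono_on hab.le
      ((by fun_prop : Continuous fun y => τ * (τ * ‖U y‖ ^ 2)).intervalIntegrable _ _)
      (hec.intervalIntegrable _ _) fun t _ => ?_
    simp only [he]
    nlinarith [sq_nonneg ‖U' t‖]
  have h7 : 0 ≤ 𝓔 := intervalIntegral.integral_nonneg hab.le fun t _ => he0 t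
  have h8 : (τ * (b - a)) * (τ * ‖U x‖ ^ 2) ≤ (τ * (b - a)) * (2 * 𝓔) := by
    have := mul_le_mul_of_nonneg_left hint hτ0.le
    nlinarith
  exact le_of_mul_le_mul_left h8 (by linarith)

/-- Testing the equation against its own solution leaves no boundary terms, so the energy vanishes
and with it all pointwise values. -/
theorem IsRegular.eq_zero {a b τ : ℝ} (hab : a < b) (hτ : 1 ≤ τ * (b - a)) {u g : EdgeL2 a b}
    {U U' : ℝ → ℂ} (h : IsRegular u g U U') (hg : -g + ((τ : ℂ) ^ 2) • u = 0) (ha : U a = 0)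
    (hb : U b = 0) : u = 0 := by
  have hτ0 : 0 < τ := by
    by_contra h
    nlinarith
  have h1 := h.inner_eq hab.le h τ
  rw [hg, ha, hb, inner_zero_right, energy_self] at h1
  simp only [map_zero, zero_mul, add_zero, sub_zero] at h1
  have h2 := Complex.ofReal_eq_zero.1 h1.symm
  apply Lp.ext
  have hmem : ∀ᵐ x ∂(volume.restrict (Set.Icc a b)), x ∈ Set.Icc a b :=
    ae_restrict_mem measurableSet_Icc
  filter_upwards [h.ae_eq, hmem, Lp.coeFn_zero ℂ 2 (volume.restrict (Set.Icc a b))] with x hx hx' h0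
  have h3 := norm_sq_le_energy hab hτ h.hasDerivAt h.continuous_deriv hx'
  rw [h2, mul_zero] at h3
  have h4 : ‖U x‖ ^ 2 = 0 := le_antisymm (nonpos_of_mul_nonpos_right h3 hτ0) (by positivity)
  rw [hx, h0]
  simpa using h4

/-- The solution of `h'' = τ² h` on `[a, b]` with the value one at one endpoint, the right one if
`s` is true, and zero at the other. -/
noncomputable def harmonic (a b τ : ℝ) (s : Bool) (x : ℝ) : ℝ :=
  (if s then Real.sinh (τ * (x - a)) else Real.sinh (τ * (b - x))) / Real.sinh (τ * (b - a))

/-- The derivative of `harmonic`. -/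
noncomputable def harmonicDeriv (a b τ : ℝ) (s : Bool) (x : ℝ) : ℝ :=
  (if s then τ * Real.cosh (τ * (x - a)) else -(τ * Real.cosh (τ * (b - x)))) /
    Real.sinh (τ * (b - a))

theorem hasDerivAt_harmonic (a b τ : ℝ) (s : Bool) (x : ℝ) :
    HasDerivAt (harmonic a b τ s) (harmonicDeriv a b τ s x) x := by
  cases s
  · have h : HasDerivAt (fun x => τ * (b - x)) (τ * (-1)) x :=
      ((hasDerivAt_id x).const_sub b).const_mul τ
    have := (h.sinh).div_const (Real.sinh (τ * (b - a)))
    convert! this using 1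
    simp [harmonicDeriv]; ring
  · have h : HasDerivAt (fun x => τ * (x - a)) (τ * 1) x :=
      ((hasDerivAt_id x).sub_const a).const_mul τ
    have := (h.sinh).div_const (Real.sinh (τ * (b - a)))
    convert! this using 1
    simp [harmonicDeriv]; ring

theorem hasDerivAt_harmonicDeriv (a b τ : ℝ) (s : Bool) (x : ℝ) :
    HasDerivAt (harmonicDeriv a b τ s) (τ ^ 2 * harmonic a b τ s x) x := by
  cases s
  · have h : HasDerivAt (fun x => τ * (b - x)) (τ * (-1)) x :=
      ((hasDerivAt_id x).const_sub b).const_mul τ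
    have := ((h.cosh.const_mul τ).neg).div_const (Real.sinh (τ * (b - a)))
    convert! this using 1
    simp [harmonic]; ring
  · have h : HasDerivAt (fun x => τ * (x - a)) (τ * 1) x :=
      ((hasDerivAt_id x).sub_const a).const_mul τ
    have := (h.cosh.const_mul τ).div_const (Real.sinh (τ * (b - a)))
    convert! this using 1
    simp [harmonic]; ring

theorem continuous_harmonic (a b τ : ℝ) (s : Bool) : Continuous (harmonic a b τ s) :=
  continuous_iff_continuousAt.2 fun x => (hasDerivAt_harmonic a b τ s x).continuousAt

/-- The function `harmonic` as an element of `L₂`. -/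
noncomputable def harmonicL2 (a b τ : ℝ) (s : Bool) : EdgeL2 a b :=
  ofContinuous a b (fun x => harmonic a b τ s x)
    (Complex.continuous_ofReal.comp (continuous_harmonic a b τ s))

theorem isRegular_harmonicL2 (a b τ : ℝ) (s : Bool) :
    IsRegular (harmonicL2 a b τ s) (((τ : ℂ) ^ 2) • harmonicL2 a b τ s)
      (fun x => harmonic a b τ s x) (fun x => harmonicDeriv a b τ s x) := by
  have h0 : ∀ᵐ x ∂(volume.restrict (Set.Icc a b)),
      harmonicL2 a b τ s x = (harmonic a b τ s x : ℂ) := coeFn_ofContinuous _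
  refine IsRegular.of_hasDerivAt (U'' := fun x => ((τ ^ 2 * harmonic a b τ s x : ℝ) : ℂ)) h0 ?_
    (fun x => (hasDerivAt_harmonic a b τ s x).ofReal_comp)
    (fun x => (hasDerivAt_harmonicDeriv a b τ s x).ofReal_comp)
    (Complex.continuous_ofReal.comp (continuous_const.mul (continuous_harmonic a b τ s)))
  filter_upwards [h0, Lp.coeFn_smul ((τ : ℂ) ^ 2) (harmonicL2 a b τ s)] with x e1 e2
  rw [e2, Pi.smul_apply, e1]
  simp

theorem harmonic_left {a b τ : ℝ} (h : 0 < τ * (b - a)) (s : Bool) :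
    harmonic a b τ s a = if s then 0 else 1 := by
  have := (Real.sinh_pos_iff.2 h).ne'
  cases s <;> simp [harmonic, this]

theorem harmonic_right {a b τ : ℝ} (h : 0 < τ * (b - a)) (s : Bool) :
    harmonic a b τ s b = if s then 1 else 0 := by
  have := (Real.sinh_pos_iff.2 h).ne'
  cases s <;> simp [harmonic, this]

/-- Solvability of `-v'' + τ² v = f` with zero boundary values. -/
theorem exists_dirichlet {a b τ : ℝ} (hab : a < b) (hτ : 0 < τ) (f : EdgeL2 a b) :
    ∃ (v g : EdgeL2 a b) (V V' : ℝ → ℂ), IsRegular v g V V' ∧ -g + ((τ : ℂ) ^ 2) • v = f ∧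
      V a = 0 ∧ V b = 0 := by
  let F₁ : ℝ → ℂ := fun x => ∫ y in a..x, f.extend y
  have hF₁ : Continuous F₁ := f.continuous_primitive
  have prim : ∀ {k : ℝ → ℂ}, Continuous k → ∀ x, HasDerivAt (fun x => ∫ y in a..x, k y) (k x) x :=
    fun hk x => intervalIntegral.integral_hasDerivAt_right (hk.intervalIntegrable _ _)
      hk.stronglyMeasurable.stronglyMeasurableAtFilter hk.continuousAt
  -- `f` is only square integrable, so variation of constants is applied to its second primitive.
  -- With `W` = -τ∫ₐˣ sinh(τ(x-y)) F₂(y) dy one has W'' = τ²(W - F₂) at every point.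
  let F₂ : ℝ → ℂ := fun x => ∫ y in a..x, F₁ y
  have hF₂ : ∀ x, HasDerivAt F₂ (F₁ x) x := prim hF₁
  have hF₂c : Continuous F₂ := continuous_iff_continuousAt.2 fun x => (hF₂ x).continuousAt
  let ex : ℝ → ℝ → ℂ := fun t x => Complex.exp ((t : ℂ) * (x : ℂ))
  have hex : ∀ t x, HasDerivAt (ex t) (t * ex t x) x := by
    intro t x
    have h1 : HasDerivAt (fun x : ℝ => (t : ℂ) * (x : ℂ)) ((t : ℂ) * 1) x :=
      ((hasDerivAt_id x).ofReal_comp).const_mul (t : ℂ)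
    have := h1.cexp
    convert! this using 1
    simp only [ex]; ring
  have hexc : ∀ t, Continuous (ex t) := fun t =>
    continuous_iff_continuousAt.2 fun x => (hex t x).continuousAt
  have hexm : ∀ x, ex τ x * ex (-τ) x = 1 := by
    intro x
    simp only [ex]
    rw [← Complex.exp_add]
    simp
  let P : ℝ → ℂ := fun x => ∫ y in a..x, ex (-τ) y * F₂ y
  let N : ℝ → ℂ := fun x => ∫ y in a..x, ex τ y * F₂ y
  have hP : ∀ x, HasDerivAt P (ex (-τ) x * F₂ x) x := prim ((hexc _).mul hF₂c)
  have hN : ∀ x, HasDerivAt N (ex τ x * F₂ x) x := prim ((hexc _).mul hF₂c)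
  let W : ℝ → ℂ := fun x => -(τ / 2 : ℂ) * (ex τ x * P x - ex (-τ) x * N x)
  let W' : ℝ → ℂ := fun x => -((τ : ℂ) ^ 2 / 2) * (ex τ x * P x + ex (-τ) x * N x)
  have hW : ∀ x, HasDerivAt W (W' x) x := by
    intro x
    have := ((((hex τ x).mul (hP x)).sub ((hex (-τ) x).mul (hN x))).const_mul (-(τ / 2 : ℂ)))
    convert! this using 1
    simp only [W', Complex.ofReal_neg]
    ring
  have hW' : ∀ x, HasDerivAt W' ((τ : ℂ) ^ 2 * (W x - F₂ x)) x := by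
    intro x
    have := ((((hex τ x).mul (hP x)).add ((hex (-τ) x).mul (hN x))).const_mul
      (-((τ : ℂ) ^ 2 / 2)))
    convert! this using 1
    simp only [W, Complex.ofReal_neg]
    linear_combination (τ : ℂ) ^ 2 * F₂ x * hexm x
  have hWc : Continuous W := continuous_iff_continuousAt.2 fun x => (hW x).continuousAt
  have hW'c : Continuous W' := continuous_iff_continuousAt.2 fun x => (hW' x).continuousAt
  -- Formally V₀'' = τ²V₀ - f. The two hyperbolic solutions are then subtracted to make the boundary
  -- values zero.
  let V₀ : ℝ → ℂ := fun x => W x - F₂ x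
  have hV₀c : Continuous V₀ := hWc.sub hF₂c
  let v₀ := ofContinuous a b V₀ hV₀c
  have hv₀ : ∀ᵐ x ∂(volume.restrict (Set.Icc a b)), v₀ x = V₀ x := coeFn_ofContinuous _
  have hreg : IsRegular v₀ (((τ : ℂ) ^ 2) • v₀ - f) V₀ (fun x => W' x - F₁ x) := by
    refine ⟨hv₀, fun x => (hW x).sub (hF₂ x), hW'c.sub hF₁, fun x hx => ?_⟩
    have hi : IntervalIntegrable (fun y => f y) volume a x :=
      (intervalIntegrable_iff_integrableOn_Ioc_of_le hx.1).2
        (f.integrableOn.mono_set fun y hy => ⟨hy.1.le, hy.2.trans hx.2⟩)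
    have hI : ∫ y in a..x, (((τ : ℂ) ^ 2) • v₀ - f) y =
        ∫ y in a..x, ((τ : ℂ) ^ 2 * (W y - F₂ y) - f y) := by
      refine intervalIntegral.integral_congr_ae ?_
      have h1 := Lp.coeFn_sub (((τ : ℂ) ^ 2) • v₀) f
      have h2 := Lp.coeFn_smul ((τ : ℂ) ^ 2) v₀
      rw [Filter.EventuallyEq, ae_restrict_iff' measurableSet_Icc] at h1 h2
      rw [ae_restrict_iff' measurableSet_Icc] at hv₀
      filter_upwards [h1, h2, hv₀] with y e1 e2 e3 hy'
      rw [Set.uIoc_of_le hx.1] at hy'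
      have hy : y ∈ Set.Icc a b := ⟨hy'.1.le, hy'.2.trans hx.2⟩
      rw [e1 hy, Pi.sub_apply, e2 hy, Pi.smul_apply, e3 hy, smul_eq_mul]
    have hc : Continuous fun y => (τ : ℂ) ^ 2 * (W y - F₂ y) := continuous_const.mul hV₀c
    rw [hI, intervalIntegral.integral_sub (hc.intervalIntegrable _ _) hi,
      intervalIntegral.integral_eq_sub_of_hasDerivAt (fun y _ => hW' y)
        (hc.intervalIntegrable _ _), ← f.integral_extend hx]
    have : F₁ a = 0 := intervalIntegral.integral_same
    rw [this]
    simp only [F₁]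
    ring
  have hpos : 0 < τ * (b - a) := mul_pos hτ (sub_pos.2 hab)
  refine ⟨_, _, _, _, (hreg.add ((isRegular_harmonicL2 a b τ false).smul (-V₀ a))).add
    ((isRegular_harmonicL2 a b τ true).smul (-V₀ b)), ?_, ?_, ?_⟩
  · module
  · simp [harmonic_left hpos]
  · simp [harmonic_right hpos]

end QuantumGraph

/-! ### The resolvent equation on the graph, reduced to a linear system at the vertices. -/

namespace QuantumGraph

open ComplexConjugate

namespace MetricGraph

variable {E V : Type*} (G : MetricGraph E V)

/-- `U` is a regular representative of `u` with derivative `U'` such that `-u'' + τ² u = f` on the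
edges, continuous at the vertices with values `c`. -/
structure Represents (τ : ℝ) (f u : ∀ e, EdgeL2 (G.left e) (G.right e)) (U U' : E → ℝ → ℂ)
    (c : V → ℂ) : Prop where
  exists_regular : ∀ e, ∃ g, IsRegular (u e) g (U e) (U' e) ∧ -g + ((τ : ℂ) ^ 2) • u e = f e
  value_eq : ∀ x : E × Bool, U x.1 (G.position x) = c (G.vertexOf x)

variable {G}

theorem position_mem (x : E × Bool) : G.position x ∈ Set.Icc (G.left x.1) (G.right x.1) := by
  have := (G.left_lt_right x.1).le
  unfold position
  split_ifs
  · exact ⟨this, le_rfl⟩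
  · exact ⟨le_rfl, this⟩

theorem Represents.add {τ : ℝ} {f u h w : ∀ e, EdgeL2 (G.left e) (G.right e)}
    {U U' W W' : E → ℝ → ℂ} {c d : V → ℂ} (H : G.Represents τ f u U U' c)
    (K : G.Represents τ h w W W' d) :
    G.Represents τ (f + h) (u + w) (fun e x => U e x + W e x) (fun e x => U' e x + W' e x)
      (c + d) where
  exists_regular e := by
    obtain ⟨g, hg, h1⟩ := H.exists_regular e
    obtain ⟨k, hk, h2⟩ := K.exists_regular e
    refine ⟨_, hg.add hk, ?_⟩
    rw [Pi.add_apply, Pi.add_apply, ← h1, ← h2]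
    module
  value_eq x := by simp only [H.value_eq, K.value_eq, Pi.add_apply]

theorem Represents.continuous {τ : ℝ} {f u : ∀ e, EdgeL2 (G.left e) (G.right e)}
    {U U' : E → ℝ → ℂ} {c : V → ℂ} (H : G.Represents τ f u U U' c) (e : E) :
    Continuous (U e) := (H.exists_regular e).choose_spec.1.continuous

theorem Represents.ae_eq {τ : ℝ} {f u : ∀ e, EdgeL2 (G.left e) (G.right e)}
    {U U' : E → ℝ → ℂ} {c : V → ℂ} (H : G.Represents τ f u U U' c) (e : E) :
    ∀ᵐ x ∂(volume.restrict (Set.Icc (G.left e) (G.right e))), u e x = U e x :=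
  (H.exists_regular e).choose_spec.1.ae_eq

theorem normalDeriv_add (x : E × Bool) (c d : ℂ) :
    normalDeriv x (c + d) = normalDeriv x c + normalDeriv x d := by
  unfold normalDeriv
  split_ifs
  · ring
  · rfl

variable [Fintype E] [DecidableEq V]

theorem sum_vertex [Fintype V] (F : E × Bool → ℂ) (c : V → ℂ) :
    ∑ x, c (G.vertexOf x) * F x = ∑ v, c v * ∑ x ∈ G.endpoints v, F x := by
  rw [← Finset.sum_fiberwise Finset.univ G.vertexOf]
  refine Finset.sum_congr rfl fun v _ => ?_
  rw [Finset.mul_sum]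
  exact Finset.sum_congr rfl fun x hx => by rw [(Finset.mem_filter.1 hx).2]

/-- The pair on the left encodes (A + τ²)u = f. The equivalence replaces weak derivatives and
almost-everywhere classes by C¹ functions with pointwise matching conditions. -/
theorem mem_deltaLaplacianGraph_iff (α : V → ℝ) (τ : ℝ) (f u : G.L2) :
    (u, f - ((τ : ℂ) ^ 2) • u) ∈ G.deltaLaplacianGraph α ↔ ∃ U U' c,
      G.Represents τ f u U U' c ∧ ∀ v, ∑ x ∈ G.endpoints v,
        normalDeriv x (U' x.1 (G.position x)) = (α v : ℂ) * c v := by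
  constructor
  · rintro ⟨u', u'', h1, h2, ⟨c, d, h3, h4, h5⟩, h6⟩
    choose U U' hU hU' using fun e => exists_isRegular (G.left_lt_right e) (h1 e) (h2 e)
    refine ⟨U, U', c, ⟨fun e => ⟨u'' e, hU e, ?_⟩, fun x => ?_⟩, fun v => ?_⟩
    · have := congrArg (fun p : G.L2 => p e) h6
      simp only [PiLp.sub_apply, PiLp.smul_apply, PiLp.neg_apply] at this
      rw [← this]
      abel
    · exact ((hasValueAt_iff (G.left_lt_right _) (hU _).continuous.continuousOn (hU _).ae_eq
        (position_mem x)).1 (h3 x)).symm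
    · rw [← h5]
      refine Finset.sum_congr rfl fun x _ => ?_
      rw [(hasValueAt_iff (G.left_lt_right _) (hU _).continuous_deriv.continuousOn (hU' _)
        (position_mem x)).1 (h4 x)]
  · rintro ⟨U, U', c, H, hm⟩
    choose g hg hgf using H.exists_regular
    refine ⟨WithLp.toLp 2 fun e => ofContinuous _ _ _ (hg e).continuous_deriv, WithLp.toLp 2 g,
      fun e => ((hg e).hasWeakDeriv (G.left_lt_right e).le).1,
      fun e => ((hg e).hasWeakDeriv (G.left_lt_right e).le).2,
      ⟨c, fun x => U' x.1 (G.position x), fun x => ?_, fun x => ?_, hm⟩, ?_⟩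
    · exact (hasValueAt_iff (G.left_lt_right _) (hg _).continuous.continuousOn (hg _).ae_eq
        (position_mem x)).2 (H.value_eq x).symm
    · exact (hasValueAt_iff (G.left_lt_right _) (hg _).continuous_deriv.continuousOn
        (coeFn_ofContinuous (hg _).continuous_deriv) (position_mem x)).2 rfl
    · ext1 e
      simp only [PiLp.sub_apply, PiLp.smul_apply, PiLp.neg_apply]
      rw [← hgf e]
      abel

/-- Green's formula on the graph. -/
theorem Represents.inner_eq [Fintype V] {τ : ℝ} {f u h w : G.L2} {U U' W W' : E → ℝ → ℂ}
    {c d : V → ℂ} (K : G.Represents τ h w W W' d) (H : G.Represents τ f u U U' c) :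
    inner ℂ w f = ∑ e, energy (G.left e) (G.right e) τ (W e) (W' e) (U e) (U' e) +
      ∑ v, conj (d v) * ∑ x ∈ G.endpoints v, normalDeriv x (U' x.1 (G.position x)) := by
  have h1 : ∀ e, inner ℂ (w e) (f e) = energy (G.left e) (G.right e) τ (W e) (W' e) (U e) (U' e) +
      ∑ s : Bool, conj (d (G.vertexOf (e, s))) *
        normalDeriv (e, s) (U' e (G.position (e, s))) := by
    intro e
    obtain ⟨g, hg, hgf⟩ := H.exists_regular e
    obtain ⟨k, hk, -⟩ := K.exists_regular e
    rw [← hgf, hk.inner_eq (G.left_lt_right e).le hg]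
    simp only [Fintype.sum_bool, ← K.value_eq, normalDeriv, position, if_true]
    simp
    ring
  rw [PiLp.inner_apply, Finset.sum_congr rfl fun e _ => h1 e, Finset.sum_add_distrib,
    ← sum_vertex (fun x => normalDeriv x (U' x.1 (G.position x))) fun v => conj (d v),
    Fintype.sum_prod_type]

variable [Fintype V]

/-- The edgewise solution of `u'' = τ² u` with vertex values `c`. -/
noncomputable def lift (G : MetricGraph E V) (τ : ℝ) (c : V → ℂ) : G.L2 :=
  WithLp.toLp 2 fun e => c (G.vertexOf (e, true)) • harmonicL2 (G.left e) (G.right e) τ true +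
    c (G.vertexOf (e, false)) • harmonicL2 (G.left e) (G.right e) τ false

/-- The function representing `lift`. -/
noncomputable def liftFun (G : MetricGraph E V) (τ : ℝ) (c : V → ℂ) (e : E) (x : ℝ) : ℂ :=
  c (G.vertexOf (e, true)) * harmonic (G.left e) (G.right e) τ true x +
    c (G.vertexOf (e, false)) * harmonic (G.left e) (G.right e) τ false x

/-- The derivative of `liftFun`. -/
noncomputable def liftDeriv (G : MetricGraph E V) (τ : ℝ) (c : V → ℂ) (e : E) (x : ℝ) : ℂ :=
  c (G.vertexOf (e, true)) * harmonicDeriv (G.left e) (G.right e) τ true x +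
    c (G.vertexOf (e, false)) * harmonicDeriv (G.left e) (G.right e) τ false x

/-- The normal derivative at the endpoint `(e, s)` of the harmonic function of the endpoint
`(e, t)`. -/
noncomputable def edgeDtN (G : MetricGraph E V) (τ : ℝ) (e : E) (s t : Bool) : ℝ :=
  (if s = t then -(τ * Real.cosh (τ * (G.right e - G.left e))) else τ) /
    Real.sinh (τ * (G.right e - G.left e))

/-- The Dirichlet-to-Neumann matrix of the graph. -/
noncomputable def dtn (G : MetricGraph E V) (τ : ℝ) : Matrix V V ℝ := fun k l =>
  ∑ e, ∑ s, ∑ t, if G.vertexOf (e, s) = k ∧ G.vertexOf (e, t) = l then G.edgeDtN τ e s t else 0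

omit [Fintype V] [Fintype E] [DecidableEq V] in
theorem represents_lift {τ : ℝ} (hτ : 0 < τ) (c : V → ℂ) :
    G.Represents τ (0 : G.L2) (G.lift τ c) (G.liftFun τ c) (G.liftDeriv τ c) c where
  exists_regular e := by
    refine ⟨_, ((isRegular_harmonicL2 _ _ τ true).smul (c (G.vertexOf (e, true)))).add
      ((isRegular_harmonicL2 _ _ τ false).smul (c (G.vertexOf (e, false)))), ?_⟩
    simp only [lift, PiLp.zero_apply]
    module
  value_eq := by
    rintro ⟨e, s⟩
    have hpos : 0 < τ * (G.right e - G.left e) := mul_pos hτ (sub_pos.2 (G.left_lt_right e))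
    cases s <;> simp [liftFun, position, harmonic_left hpos, harmonic_right hpos]

omit [DecidableEq V] [Fintype V] [Fintype E] in
theorem normalDeriv_liftDeriv (τ : ℝ) (c : V → ℂ) (x : E × Bool) :
    normalDeriv x (G.liftDeriv τ c x.1 (G.position x)) =
      ∑ t, (G.edgeDtN τ x.1 x.2 t : ℂ) * c (G.vertexOf (x.1, t)) := by
  obtain ⟨e, s⟩ := x
  cases s <;>
  · simp [normalDeriv, liftDeriv, position, harmonicDeriv, edgeDtN]
    ring

/-- This is what makes `dtn` the Dirichlet-to-Neumann matrix: it sends vertex values to sums of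
inward normal derivatives. -/
theorem sum_normalDeriv_lift (τ : ℝ) (c : V → ℂ) (k : V) :
    ∑ x ∈ G.endpoints k, normalDeriv x (G.liftDeriv τ c x.1 (G.position x)) =
      ∑ l, (G.dtn τ k l : ℂ) * c l := by
  have h1 : ∀ l, (G.dtn τ k l : ℂ) * c l = ∑ e, ∑ s, ∑ t, if G.vertexOf (e, s) = k then
      (if G.vertexOf (e, t) = l then (G.edgeDtN τ e s t : ℂ) * c l else 0) else 0 := by
    intro l
    simp only [dtn, Complex.ofReal_sum, Finset.sum_mul]
    refine Finset.sum_congr rfl fun e _ => Finset.sum_congr rfl fun s _ =>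
      Finset.sum_congr rfl fun t _ => ?_
    split_ifs <;> simp_all
  simp only [h1]
  rw [Finset.sum_comm]
  simp only [endpoints, Finset.sum_filter, normalDeriv_liftDeriv, Fintype.sum_prod_type]
  refine Finset.sum_congr rfl fun e _ => ?_
  rw [Finset.sum_comm]
  refine Finset.sum_congr rfl fun s _ => ?_
  rw [Finset.sum_comm]
  split_ifs with h
  · refine Finset.sum_congr rfl fun t _ => ?_
    simp
  · simp

omit [Fintype V] in
theorem dtn_symm (τ : ℝ) (k l : V) : G.dtn τ k l = G.dtn τ l k := by
  unfold dtn
  refine Finset.sum_congr rfl fun e _ => ?_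
  rw [Finset.sum_comm]
  refine Finset.sum_congr rfl fun s _ => Finset.sum_congr rfl fun t _ => ?_
  simp only [and_comm, edgeDtN, eq_comm (a := s)]

/-- Green's second identity for `u` and the lift of a unit vector: the energy terms cancel and the
symmetry of `dtn` remains to be used. Combined with the matching conditions it becomes a linear
system for the vertex values. -/
theorem Represents.inner_lift {τ : ℝ} (hτ : 0 < τ) {f u : G.L2} {U U' : E → ℝ → ℂ}
    {c : V → ℂ} (H : G.Represents τ f u U U' c) (k : V) :
    inner ℂ (G.lift τ (Pi.single k 1)) f =
      ∑ x ∈ G.endpoints k, normalDeriv x (U' x.1 (G.position x)) - ∑ l, (G.dtn τ k l : ℂ) * c l := by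
  have h1 := (represents_lift hτ (Pi.single k 1)).inner_eq H
  have h2 := congrArg conj (H.inner_eq (represents_lift hτ (Pi.single k 1)))
  simp only [inner_zero_right, map_zero, map_add, map_sum, energy_conj, sum_normalDeriv_lift,
    map_mul, Complex.conj_conj, Complex.conj_ofReal] at h2
  rw [h1, ← sub_zero (_ + _), h2]
  have h3 : ∀ v, c v * ∑ l, (G.dtn τ v l : ℂ) * conj ((Pi.single k 1 : V → ℂ) l) =
      (G.dtn τ k v : ℂ) * c v := by
    intro v
    rw [Finset.sum_eq_single k]
    · simp [dtn_symm τ v k, mul_comm]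
    · intro l _ hl
      simp [hl]
    · simp
  simp only [h3]
  have h4 : ∑ v, conj ((Pi.single k 1 : V → ℂ) v) * ∑ x ∈ G.endpoints v,
      normalDeriv x (U' x.1 (G.position x)) =
      ∑ x ∈ G.endpoints k, normalDeriv x (U' x.1 (G.position x)) := by
    rw [Finset.sum_eq_single k]
    · simp
    · intro l _ hl
      simp [hl]
    · simp
  rw [h4]
  ring

/-- The spectral parameter `-τ²` lies below the spectrum and beyond the scale of the edges. -/
structure Admissible (G : MetricGraph E V) (α : V → ℝ) (τ : ℝ) : Prop where
  pos : 0 < τ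
  one_le : ∀ e, 1 ≤ τ * (G.right e - G.left e)
  le : 4 * ∑ v, |α v| ≤ τ

/-- Solutions are controlled pointwise by the quadratic form of the resolvent. -/
theorem Represents.norm_sq_le {α : V → ℝ} {τ : ℝ} (hτ : G.Admissible α τ) {f u : G.L2}
    {U U' : E → ℝ → ℂ} {c : V → ℂ} (H : G.Represents τ f u U U' c)
    (hm : ∀ v, ∑ x ∈ G.endpoints v, normalDeriv x (U' x.1 (G.position x)) = (α v : ℂ) * c v)
    (e : E) {x : ℝ} (hx : x ∈ Set.Icc (G.left e) (G.right e)) :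
    τ * ‖U e x‖ ^ 2 ≤ 4 * (inner ℂ u f).re := by
  let en : E → ℝ := fun e =>
    ∫ y in (G.left e)..(G.right e), (‖U' e y‖ ^ 2 + τ ^ 2 * ‖U e y‖ ^ 2)
  have hen0 : ∀ e, 0 ≤ en e := fun e =>
    intervalIntegral.integral_nonneg (G.left_lt_right e).le fun y _ => by positivity
  have hsup : ∀ e, ∀ x ∈ Set.Icc (G.left e) (G.right e), τ * ‖U e x‖ ^ 2 ≤ 2 * ∑ e, en e := by
    intro e x hx
    obtain ⟨g, hg, -⟩ := H.exists_regular e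
    refine (norm_sq_le_energy (G.left_lt_right e) (hτ.one_le e) hg.hasDerivAt
      hg.continuous_deriv hx).trans ?_
    gcongr
    exact Finset.single_le_sum (f := en) (fun e _ => hen0 e) (Finset.mem_univ e)
  have hc : ∀ v, τ * ‖c v‖ ^ 2 ≤ 2 * ∑ e, en e := by
    intro v
    obtain ⟨y, rfl⟩ := G.vertexOf_surjective v
    rw [← H.value_eq]
    exact hsup _ _ (position_mem y)
  have hin : (inner ℂ u f).re = ∑ e, en e + ∑ v, α v * ‖c v‖ ^ 2 := by
    rw [H.inner_eq H]
    have h1 : ∀ v, conj (c v) * ((α v : ℂ) * c v) = ((α v * ‖c v‖ ^ 2 : ℝ) : ℂ) := by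
      intro v
      rw [mul_left_comm, Complex.conj_mul']
      push_cast
      rfl
    simp only [hm, h1, energy_self, ← Complex.ofReal_sum, ← Complex.ofReal_add, Complex.ofReal_re]
    rfl
  have hlow : -(τ * ∑ v, α v * ‖c v‖ ^ 2) ≤ (∑ v, |α v|) * (2 * ∑ e, en e) := by
    rw [Finset.mul_sum, ← Finset.sum_neg_distrib, Finset.sum_mul]
    refine Finset.sum_le_sum fun v _ => ?_
    calc -(τ * (α v * ‖c v‖ ^ 2)) = (-α v) * (τ * ‖c v‖ ^ 2) := by ring
      _ ≤ |α v| * (τ * ‖c v‖ ^ 2) :=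
        mul_le_mul_of_nonneg_right (neg_le_abs _) (mul_nonneg hτ.pos.le (by positivity))
      _ ≤ |α v| * (2 * ∑ e, en e) := mul_le_mul_of_nonneg_left (hc v) (abs_nonneg _)
  have hs0 : 0 ≤ ∑ e, en e := Finset.sum_nonneg fun e _ => hen0 e
  -- The constant 4 in `Admissible` is chosen here: the vertex terms consume at most half of the
  -- energy, so the form is at least the other half, and 2·energy ≤ 4·form.
  have h2 : (∑ v, |α v|) * (2 * ∑ e, en e) ≤ τ * ((∑ e, en e) / 2) := by
    have := mul_le_mul_of_nonneg_right hτ.le hs0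
    nlinarith
  have h3 : -(∑ v, α v * ‖c v‖ ^ 2) ≤ (∑ e, en e) / 2 := by
    refine le_of_mul_le_mul_left ?_ hτ.pos
    linarith
  have := hsup e x hx
  rw [hin]
  linarith

theorem Represents.eq_zero {α : V → ℝ} {τ : ℝ} (hτ : G.Admissible α τ) {u : G.L2}
    {U U' : E → ℝ → ℂ} {c : V → ℂ} (H : G.Represents τ (0 : G.L2) u U U' c)
    (hm : ∀ v, ∑ x ∈ G.endpoints v, normalDeriv x (U' x.1 (G.position x)) = (α v : ℂ) * c v) :
    u = 0 ∧ c = 0 := by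
  have h1 : ∀ e, ∀ x ∈ Set.Icc (G.left e) (G.right e), U e x = 0 := by
    intro e x hx
    have h2 := H.norm_sq_le hτ hm e hx
    rw [inner_zero_right, Complex.zero_re, mul_zero] at h2
    have h4 : ‖U e x‖ ^ 2 = 0 := le_antisymm (nonpos_of_mul_nonpos_right h2 hτ.pos) (by positivity)
    simpa using h4
  constructor
  · ext1 e
    apply Lp.ext
    have hmem : ∀ᵐ x ∂(volume.restrict (Set.Icc (G.left e) (G.right e))),
        x ∈ Set.Icc (G.left e) (G.right e) := ae_restrict_mem measurableSet_Icc
    filter_upwards [H.ae_eq e, hmem, Lp.coeFn_zero ℂ 2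
      (volume.restrict (Set.Icc (G.left e) (G.right e)))] with x hx hx' h0
    rw [hx, h1 e x hx', PiLp.zero_apply, h0]
    rfl
  · ext v
    obtain ⟨y, rfl⟩ := G.vertexOf_surjective v
    rw [← H.value_eq, h1 _ _ (position_mem y)]
    rfl

/-- The vertex matrix of the resolvent equation. -/
noncomputable def vertexMatrix (G : MetricGraph E V) (α : V → ℝ) (τ : ℝ) : Matrix V V ℝ :=
  Matrix.diagonal α - G.dtn τ

theorem sum_vertexMatrix_mul (α : V → ℝ) (τ : ℝ) (c : V → ℂ) (k : V) :
    ∑ j, (G.vertexMatrix α τ k j : ℂ) * c j = α k * c k - ∑ j, (G.dtn τ k j : ℂ) * c j := by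
  simp only [vertexMatrix, Matrix.sub_apply, Complex.ofReal_sub, sub_mul,
    Finset.sum_sub_distrib, Matrix.diagonal_apply]
  rw [Finset.sum_eq_single k]
  · simp
  · intro j _ hj
    simp [hj.symm]
  · simp

/-- A vector in the kernel lifts to a solution of the homogeneous equation satisfying the matching
conditions, which is zero by coercivity. -/
theorem isUnit_det_vertexMatrix {α : V → ℝ} {τ : ℝ} (hτ : G.Admissible α τ) :
    IsUnit (G.vertexMatrix α τ).det := by
  rw [isUnit_iff_ne_zero]
  intro h
  obtain ⟨c, hc, hc0⟩ := Matrix.exists_mulVec_eq_zero_iff.2 h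
  refine hc ?_
  have h1 := ((represents_lift (G := G) hτ.pos fun v => (c v : ℂ)).eq_zero hτ fun v => by
    rw [sum_normalDeriv_lift]
    have := congrFun hc0 v
    rw [vertexMatrix, Matrix.sub_mulVec, Pi.sub_apply, Matrix.mulVec_diagonal, Pi.zero_apply,
      sub_eq_zero] at this
    rw [← Complex.ofReal_mul, this, Matrix.mulVec, dotProduct]
    push_cast
    rfl).2
  ext v
  have := congrFun h1 v
  simpa using this

/-- The matching conditions turn `inner_lift` into M c = (⟨g_k, f⟩)_k with M the vertex matrix;
inverting M gives the values on which Krein's formula rests. -/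
theorem Represents.value_formula {α : V → ℝ} {τ : ℝ} (hτ : G.Admissible α τ) {f u : G.L2}
    {U U' : E → ℝ → ℂ} {c : V → ℂ} (H : G.Represents τ f u U U' c)
    (hm : ∀ v, ∑ x ∈ G.endpoints v, normalDeriv x (U' x.1 (G.position x)) = (α v : ℂ) * c v)
    (l : V) :
    c l = ∑ k, (((G.vertexMatrix α τ)⁻¹ l k : ℝ) : ℂ) * inner ℂ (G.lift τ (Pi.single k 1)) f := by
  have h1 : ∀ k, inner ℂ (G.lift τ (Pi.single k 1)) f = ∑ j, (G.vertexMatrix α τ k j : ℂ) * c j := by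
    intro k
    rw [H.inner_lift hτ.pos, hm]
    rw [sum_vertexMatrix_mul]
  have h2 : ∀ j, ∑ k, (((G.vertexMatrix α τ)⁻¹ l k : ℝ) : ℂ) * (G.vertexMatrix α τ k j : ℂ) =
      if l = j then 1 else 0 := by
    intro j
    have := congrFun (congrFun (Matrix.nonsing_inv_mul _ (isUnit_det_vertexMatrix (G := G) hτ)) l) j
    rw [Matrix.mul_apply, Matrix.one_apply] at this
    split_ifs at this ⊢ <;> exact_mod_cast this
  simp only [h1, Finset.mul_sum, ← mul_assoc]
  rw [Finset.sum_comm]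
  simp only [← Finset.sum_mul, h2]
  simp

/-- Solve with Dirichlet conditions at all vertices, then add the lift of the vertex values dictated
by `value_formula`; it repairs the normal derivatives without changing the equation. -/
theorem exists_represents {α : V → ℝ} {τ : ℝ} (hτ : G.Admissible α τ) (f : G.L2) :
    ∃ (u : G.L2) (U U' : E → ℝ → ℂ) (c : V → ℂ), G.Represents τ f u U U' c ∧
      ∀ v, ∑ x ∈ G.endpoints v, normalDeriv x (U' x.1 (G.position x)) = (α v : ℂ) * c v := by
  choose w g W W' hW hWf hWa hWb using fun e => exists_dirichlet (G.left_lt_right e) hτ.pos (f e)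
  have K : G.Represents τ f (WithLp.toLp 2 w : G.L2) W W' 0 := by
    refine ⟨fun e => ⟨g e, hW e, hWf e⟩, ?_⟩
    rintro ⟨e, s⟩
    cases s <;> simp [position, hWa, hWb]
  let c : V → ℂ := fun l =>
    ∑ k, (((G.vertexMatrix α τ)⁻¹ l k : ℝ) : ℂ) * inner ℂ (G.lift τ (Pi.single k 1)) f
  have H := K.add (represents_lift hτ.pos c)
  refine ⟨WithLp.toLp 2 w + G.lift τ c, _, _, c, by simpa using H, fun v => ?_⟩
  have h1 := K.inner_lift hτ.pos v
  simp only [Pi.zero_apply, mul_zero, Finset.sum_const_zero, sub_zero] at h1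
  simp only [normalDeriv_add, Finset.sum_add_distrib, sum_normalDeriv_lift, ← h1]
  have h2 : ∀ j, ∑ k, (G.vertexMatrix α τ v k : ℂ) * (((G.vertexMatrix α τ)⁻¹ k j : ℝ) : ℂ) =
      if v = j then 1 else 0 := by
    intro j
    have := congrFun (congrFun (Matrix.mul_nonsing_inv _ (isUnit_det_vertexMatrix (G := G) hτ)) v) j
    rw [Matrix.mul_apply, Matrix.one_apply] at this
    split_ifs at this ⊢ <;> exact_mod_cast this
  have h3 : ∑ l, (G.vertexMatrix α τ v l : ℂ) * c l = inner ℂ (G.lift τ (Pi.single v 1)) f := by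
    simp only [c, Finset.mul_sum, ← mul_assoc]
    rw [Finset.sum_comm]
    simp only [← Finset.sum_mul, h2]
    simp
  rw [← h3, sum_vertexMatrix_mul]
  simp

end MetricGraph

end QuantumGraph

/-! ### The resolvent as a trace class operator, Krein's formula and the trace identity. -/

namespace QuantumGraph

open ComplexConjugate

theorem norm_sq_eq_integral {a b : ℝ} (hab : a ≤ b) {u : EdgeL2 a b} {U : ℝ → ℂ}
    (h : ∀ᵐ x ∂(volume.restrict (Set.Icc a b)), u x = U x) :
    ‖u‖ ^ 2 = ∫ x in a..b, ‖U x‖ ^ 2 := by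
  have h1 : inner ℂ u u = ((∫ x in a..b, ‖U x‖ ^ 2 : ℝ) : ℂ) := by
    rw [L2.inner_def, ← intervalIntegral.integral_ofReal, ← setIntegral_Icc_eq_intervalIntegral hab]
    refine integral_congr_ae ?_
    filter_upwards [h] with x hx
    rw [hx, inner_self_eq_norm_sq_to_K]
    push_cast
    rfl
  have h2 := congrArg RCLike.re h1
  rw [inner_self_eq_norm_sq] at h2
  simpa using h2

namespace MetricGraph

variable {E V : Type*} {G : MetricGraph E V} [Fintype E]

/-- The total length of the graph. -/
noncomputable def length (G : MetricGraph E V) : ℝ := ∑ e, (G.right e - G.left e)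

/-- A Bessel type inequality for families with a pointwise quadratic bound. -/
theorem sum_norm_sq_div_le {ι : Type*} (s : Finset ι) (u : ι → G.L2) (U : ι → E → ℝ → ℂ)
    (hc : ∀ i e, Continuous (U i e))
    (hae : ∀ i e, ∀ᵐ x ∂(volume.restrict (Set.Icc (G.left e) (G.right e))), u i e x = U i e x)
    (w : ι → ℝ) (hw : ∀ i, 0 < w i) {K : ℝ} (hK : 0 ≤ K)
    (h : ∀ c : ι → ℂ, ∀ e, ∀ x ∈ Set.Icc (G.left e) (G.right e),
      ‖∑ i ∈ s, c i * U i e x‖ ^ 2 ≤ K * ∑ i ∈ s, w i * ‖c i‖ ^ 2) :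
    ∑ i ∈ s, ‖u i‖ ^ 2 / w i ≤ K * G.length := by
  have hpt : ∀ e, ∀ x ∈ Set.Icc (G.left e) (G.right e), ∑ i ∈ s, ‖U i e x‖ ^ 2 / w i ≤ K := by
    intro e x hx
    set t := ∑ i ∈ s, ‖U i e x‖ ^ 2 / w i with ht
    -- The extremal coefficients in Cauchy–Schwarz: the hypothesis becomes t² ≤ K t for the
    -- pointwise sum t. Integration over the graph then produces the factor `length`.
    have h1 := h (fun i => conj (U i e x) / w i) e x hx
    have h2 : ∑ i ∈ s, conj (U i e x) / w i * U i e x = ((t : ℝ) : ℂ) := by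
      rw [ht]
      push_cast
      refine Finset.sum_congr rfl fun i _ => ?_
      rw [← Complex.conj_mul']
      ring
    have h3 : ∑ i ∈ s, w i * ‖conj (U i e x) / w i‖ ^ 2 = t := by
      refine Finset.sum_congr rfl fun i _ => ?_
      rw [norm_div, RCLike.norm_conj, Complex.norm_real, Real.norm_of_nonneg (hw i).le]
      have := (hw i).ne'
      field_simp
    rw [h2, h3, Complex.norm_real, Real.norm_eq_abs, sq_abs] at h1
    have ht0 : 0 ≤ t := Finset.sum_nonneg fun i _ => div_nonneg (by positivity) (hw i).le
    rcases ht0.eq_or_lt with h0 | h0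
    · rw [← h0]; exact hK
    · nlinarith
  have h1 : ∀ i, ‖u i‖ ^ 2 / w i = ∑ e, ∫ x in (G.left e)..(G.right e), ‖U i e x‖ ^ 2 / w i := by
    intro i
    rw [PiLp.norm_sq_eq_of_L2, Finset.sum_div]
    refine Finset.sum_congr rfl fun e _ => ?_
    rw [intervalIntegral.integral_div, norm_sq_eq_integral (G.left_lt_right e).le (hae i e)]
  have hci : ∀ i e, Continuous fun x => ‖U i e x‖ ^ 2 / w i := fun i e =>
    ((hc i e).norm.pow 2).div_const _
  rw [Finset.sum_congr rfl fun i _ => h1 i, Finset.sum_comm, length, Finset.mul_sum]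
  refine Finset.sum_le_sum fun e _ => ?_
  rw [← intervalIntegral.integral_finsetSum fun i _ => (hci i e).intervalIntegrable _ _]
  have h2 := intervalIntegral.integral_mono_on (G.left_lt_right e).le
    ((continuous_finsetSum s fun i _ => hci i e).intervalIntegrable (μ := volume) _ _)
    (intervalIntegrable_const (c := K)) (hpt e)
  rw [intervalIntegral.integral_const, smul_eq_mul, mul_comm] at h2
  exact h2

theorem norm_sq_le_mul_length {u : G.L2} {U : E → ℝ → ℂ} (hc : ∀ e, Continuous (U e))
    (hae : ∀ e, ∀ᵐ x ∂(volume.restrict (Set.Icc (G.left e) (G.right e))), u e x = U e x)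
    {K : ℝ} (h : ∀ e, ∀ x ∈ Set.Icc (G.left e) (G.right e), ‖U e x‖ ^ 2 ≤ K) :
    ‖u‖ ^ 2 ≤ K * G.length := by
  rw [PiLp.norm_sq_eq_of_L2, length, Finset.mul_sum]
  refine Finset.sum_le_sum fun e _ => ?_
  rw [norm_sq_eq_integral (G.left_lt_right e).le (hae e)]
  have h2 := intervalIntegral.integral_mono_on (G.left_lt_right e).le
    (((hc e).norm.pow 2).intervalIntegrable (μ := volume) _ _)
    (intervalIntegrable_const (c := K)) (h e)
  rw [intervalIntegral.integral_const, smul_eq_mul, mul_comm] at h2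
  exact h2

omit [Fintype E] in
theorem Represents.smul {τ : ℝ} {f u : ∀ e, EdgeL2 (G.left e) (G.right e)}
    {U U' : E → ℝ → ℂ} {c : V → ℂ} (z : ℂ) (H : G.Represents τ f u U U' c) :
    G.Represents τ (z • f) (z • u) (fun e x => z * U e x) (fun e x => z * U' e x) (z • c) where
  exists_regular e := by
    obtain ⟨g, hg, h1⟩ := H.exists_regular e
    refine ⟨_, hg.smul z, ?_⟩
    rw [Pi.smul_apply, Pi.smul_apply, ← h1]
    module
  value_eq x := by simp only [H.value_eq, Pi.smul_apply, smul_eq_mul]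

variable [DecidableEq V] [Fintype V]

omit [DecidableEq V] [Fintype V] [Fintype E] in
theorem Represents.eq_zero_of_value_eq_zero {τ : ℝ} (hτ : ∀ e, 1 ≤ τ * (G.right e - G.left e))
    {u : G.L2} {U U' : E → ℝ → ℂ} (H : G.Represents τ (0 : G.L2) u U U' 0) : u = 0 := by
  ext1 e
  obtain ⟨g, hg, h1⟩ := H.exists_regular e
  have ha := H.value_eq (e, false)
  have hb := H.value_eq (e, true)
  simp only [position] at ha hb
  exact hg.eq_zero (G.left_lt_right e) (hτ e) h1 (by simpa using ha) (by simpa using hb)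

theorem eq_of_mem_deltaLaplacianGraph {α : V → ℝ} {τ : ℝ} (hτ : G.Admissible α τ) {f u w : G.L2}
    (hu : (u, f - ((τ : ℂ) ^ 2) • u) ∈ G.deltaLaplacianGraph α)
    (hw : (w, f - ((τ : ℂ) ^ 2) • w) ∈ G.deltaLaplacianGraph α) : u = w := by
  have h := Submodule.sub_mem _ hu hw
  have h1 : (u - w, (0 : G.L2) - ((τ : ℂ) ^ 2) • (u - w)) ∈ G.deltaLaplacianGraph α := by
    convert! h using 1
    rw [Prod.mk_sub_mk]
    congr 1
    module
  obtain ⟨U, U', c, H, hm⟩ := (mem_deltaLaplacianGraph_iff α τ 0 (u - w)).1 h1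
  exact sub_eq_zero.1 (H.eq_zero hτ hm).1

/-- The resolvent of the graph Laplacian as a bounded operator. -/
theorem exists_resolvent {α : V → ℝ} {τ : ℝ} (hτ : G.Admissible α τ) :
    ∃ R : G.L2 →L[ℂ] G.L2, ∀ f u,
      (u, f - ((τ : ℂ) ^ 2) • u) ∈ G.deltaLaplacianGraph α ↔ R f = u := by
  have hex : ∀ f : G.L2, ∃ u, (u, f - ((τ : ℂ) ^ 2) • u) ∈ G.deltaLaplacianGraph α := by
    intro f
    obtain ⟨u, U, U', c, H⟩ := exists_represents hτ f
    exact ⟨u, (mem_deltaLaplacianGraph_iff α τ f u).2 ⟨U, U', c, H⟩⟩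
  choose R hR using hex
  -- Linearity follows from uniqueness, because the graph is a linear subspace.
  have hadd : ∀ f g, R (f + g) = R f + R g := by
    intro f g
    refine eq_of_mem_deltaLaplacianGraph hτ (hR (f + g)) ?_
    have h := Submodule.add_mem _ (hR f) (hR g)
    convert! h using 1
    rw [Prod.mk_add_mk]
    congr 1
    module
  have hsmul : ∀ (z : ℂ) f, R (z • f) = z • R f := by
    intro z f
    refine eq_of_mem_deltaLaplacianGraph hτ (hR (z • f)) ?_
    have h := Submodule.smul_mem _ z (hR f)
    convert! h using 1
    rw [Prod.smul_mk]
    congr 1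
    module
  have hlen : 0 ≤ G.length := Finset.sum_nonneg fun e _ => (sub_pos.2 (G.left_lt_right e)).le
  let R₀ : G.L2 →ₗ[ℂ] G.L2 := ⟨⟨R, hadd⟩, hsmul⟩
  refine ⟨R₀.mkContinuous (4 / τ * G.length) fun f => ?_, fun f u => ⟨fun h => ?_, ?_⟩⟩
  · change ‖R f‖ ≤ _
    obtain ⟨U, U', c, H, hm⟩ := (mem_deltaLaplacianGraph_iff α τ f (R f)).1 (hR f)
    have h1 : ‖R f‖ ^ 2 ≤ (4 / τ * (‖R f‖ * ‖f‖)) * G.length := by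
      refine norm_sq_le_mul_length H.continuous H.ae_eq fun e x hx => ?_
      have h2 := H.norm_sq_le hτ hm e hx
      have h3 : (inner ℂ (R f) f).re ≤ ‖R f‖ * ‖f‖ :=
        (Complex.re_le_norm _).trans (norm_inner_le_norm _ _)
      rw [div_mul_eq_mul_div, le_div_iff₀ hτ.pos]
      linarith
    rcases (norm_nonneg (R f)).eq_or_lt with h0 | h0
    · rw [← h0]
      have := hτ.pos
      positivity
    · refine le_of_mul_le_mul_left ?_ h0
      calc ‖R f‖ * ‖R f‖ = ‖R f‖ ^ 2 := by ring
        _ ≤ _ := h1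
        _ = _ := by ring
  · exact eq_of_mem_deltaLaplacianGraph hτ (hR f) h
  · rintro rfl
    exact hR f

section Resolvent

variable {α : V → ℝ} {τ : ℝ} {R : G.L2 →L[ℂ] G.L2}

omit [Fintype V] in
theorem resolvent_represents
    (hR : ∀ f u, (u, f - ((τ : ℂ) ^ 2) • u) ∈ G.deltaLaplacianGraph α ↔ R f = u) (f : G.L2) :
    ∃ U U' c, G.Represents τ f (R f) U U' c ∧ ∀ v, ∑ x ∈ G.endpoints v,
        normalDeriv x (U' x.1 (G.position x)) = (α v : ℂ) * c v :=
  (mem_deltaLaplacianGraph_iff α τ f (R f)).1 ((hR f _).2 rfl)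

/-- By Green's formula ⟨R g, f⟩ is the energy form plus a vertex sum with the coefficients `α`; both
are Hermitian because `α` is real. -/
theorem resolvent_isSymmetric
    (hR : ∀ f u, (u, f - ((τ : ℂ) ^ 2) • u) ∈ G.deltaLaplacianGraph α ↔ R f = u) :
    (R : G.L2 →ₗ[ℂ] G.L2).IsSymmetric := by
  intro f g
  obtain ⟨U, U', c, H, hm⟩ := resolvent_represents hR f
  obtain ⟨W, W', d, K, km⟩ := resolvent_represents hR g
  have h1 := congrArg conj (K.inner_eq H)
  have h2 := H.inner_eq K
  simp only [hm, km, map_add, map_sum, map_mul, energy_conj, Complex.conj_conj,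
    Complex.conj_ofReal, inner_conj_symm] at h1 h2
  simp only [ContinuousLinearMap.coe_coe]
  rw [h1, h2]
  congr 1
  refine Finset.sum_congr rfl fun v _ => ?_
  ring

/-- A pointwise bound for the range of the resolvent. -/
theorem resolvent_value_le (hτ : G.Admissible α τ)
    (hR : ∀ f u, (u, f - ((τ : ℂ) ^ 2) • u) ∈ G.deltaLaplacianGraph α ↔ R f = u) (f : G.L2) (e : E)
    {x : ℝ} (hx : x ∈ Set.Icc (G.left e) (G.right e)) {z : ℂ} (hz : HasValueAt (R f e) x z) :
    ‖z‖ ^ 2 ≤ 4 / τ * (inner ℂ (R f) f).re := by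
  obtain ⟨U, U', c, H, hm⟩ := resolvent_represents hR f
  rw [(hasValueAt_iff (G.left_lt_right e) (H.continuous e).continuousOn (H.ae_eq e) hx).1 hz,
    div_mul_eq_mul_div, le_div_iff₀ hτ.pos]
  linarith [H.norm_sq_le hτ hm e hx]

/-- The form dominates |u(x)|² at any point x, and a point exists because there is at least one
edge. -/
theorem resolvent_nonneg (hτ : G.Admissible α τ)
    (hR : ∀ f u, (u, f - ((τ : ℂ) ^ 2) • u) ∈ G.deltaLaplacianGraph α ↔ R f = u) (f : G.L2) :
    0 ≤ (inner ℂ f (R f)).re := by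
  obtain ⟨U, U', c, H, hm⟩ := resolvent_represents hR f
  obtain ⟨e⟩ := G.nonempty_edges
  have h1 := H.norm_sq_le hτ hm e (Set.left_mem_Icc.2 (G.left_lt_right e).le)
  have h2 : (inner ℂ f (R f)).re = (inner ℂ (R f) f).re := by
    rw [← inner_conj_symm, Complex.conj_re]
  have h3 : 0 ≤ τ * ‖U e (G.left e)‖ ^ 2 := mul_nonneg hτ.pos.le (by positivity)
  rw [h2]
  linarith

/-- The Bessel type inequality for images under the resolvent. -/
theorem resolvent_sum_norm_sq_div_le (hτ : G.Admissible α τ)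
    (hR : ∀ f u, (u, f - ((τ : ℂ) ^ 2) • u) ∈ G.deltaLaplacianGraph α ↔ R f = u)
    {ι : Type*} (s : Finset ι) (f : ι → G.L2) (w : ι → ℝ) (hw : ∀ i, 0 < w i) {K : ℝ} (hK : 0 ≤ K)
    (h : ∀ c : ι → ℂ, 4 / τ * (inner ℂ (R (∑ i ∈ s, c i • f i)) (∑ i ∈ s, c i • f i)).re ≤
      K * ∑ i ∈ s, w i * ‖c i‖ ^ 2) :
    ∑ i ∈ s, ‖R (f i)‖ ^ 2 / w i ≤ K * G.length := by
  choose U U' d H hm using fun i => resolvent_represents hR (f i)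
  refine sum_norm_sq_div_le s (fun i => R (f i)) U (fun i => (H i).continuous)
    (fun i => (H i).ae_eq) w hw hK fun c e x hx => ?_
  refine le_trans ?_ (h c)
  refine resolvent_value_le hτ hR _ e hx ?_
  have hval : ∀ i, HasValueAt (R (f i) e) x (U i e x) := fun i =>
    ⟨U i e, ((H i).continuous e).continuousOn, (H i).ae_eq e, rfl⟩
  clear h
  induction s using Finset.cons_induction with
  | empty => simpa using HasValueAt.zero x
  | cons i s hi ih =>
    rw [Finset.sum_cons, Finset.sum_cons, map_add, map_smul]
    exact ((hval i).smul (c i)).add ih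

theorem isCompactOperator_resolvent (hτ : G.Admissible α τ)
    (hR : ∀ f u, (u, f - ((τ : ℂ) ^ 2) • u) ∈ G.deltaLaplacianGraph α ↔ R f = u) :
    IsCompactOperator R := by
  have hK : 0 ≤ 4 / τ * ‖R‖ := mul_nonneg (div_nonneg (by norm_num) hτ.pos.le) (norm_nonneg R)
  refine isCompactOperator_of_sum_norm_sq_le (4 / τ * ‖R‖ * G.length) fun w hw s => ?_
  -- With unit weights the form bound is ⟨R g, g⟩ ≤ ‖R‖‖g‖², which gives a Hilbert–Schmidt estimate.
  have h1 := resolvent_sum_norm_sq_div_le hτ hR s (fun i : w => (i : G.L2)) (fun _ => 1)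
    (fun _ => one_pos) hK fun c => ?_
  · simpa using h1
  · set g := ∑ i ∈ s, c i • (i : G.L2)
    have h2 : ‖g‖ ^ 2 = ∑ i ∈ s, ‖c i‖ ^ 2 := by
      have := hw.inner_sum c c s
      simp only [Complex.conj_mul', ← Complex.ofReal_pow, ← Complex.ofReal_sum] at this
      have h3 := congrArg RCLike.re this
      rw [inner_self_eq_norm_sq] at h3
      simpa [← Complex.ofReal_pow] using h3
    simp only [one_mul]
    rw [← h2, mul_assoc]
    refine mul_le_mul_of_nonneg_left ?_ (div_nonneg (by norm_num) hτ.pos.le)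
    calc (inner ℂ (R g) g).re ≤ ‖R g‖ * ‖g‖ :=
          (Complex.re_le_norm _).trans (norm_inner_le_norm _ _)
      _ ≤ (‖R‖ * ‖g‖) * ‖g‖ := by gcongr; exact R.le_opNorm g
      _ = ‖R‖ * ‖g‖ ^ 2 := by ring

/-- The resolvent is trace class. -/
theorem resolvent_sum_eigenvalues_le (hτ : G.Admissible α τ)
    (hR : ∀ f u, (u, f - ((τ : ℂ) ^ 2) • u) ∈ G.deltaLaplacianGraph α ↔ R f = u)
    {ι : Type*} (s : Finset ι) (e : ι → G.L2) (l : ι → ℝ) (he : Orthonormal ℂ e)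
    (hl : ∀ i, 0 < l i) (hRe : ∀ i, R (e i) = (l i : ℂ) • e i) :
    ∑ i ∈ s, l i ≤ 4 / τ * G.length := by
  have hK : 0 ≤ 4 / τ := div_nonneg (by norm_num) hτ.pos.le
  -- On eigenvectors the form is exactly ∑ l_i|c_i|². Weighting by the eigenvalues makes ‖R
  -- e_i‖²/l_i = l_i and improves Hilbert–Schmidt to trace class.
  have h1 := resolvent_sum_norm_sq_div_le hτ hR s e l hl hK fun c => ?_
  · refine le_trans (le_of_eq (Finset.sum_congr rfl fun i _ => ?_)) h1
    rw [hRe, norm_smul, he.1 i, Complex.norm_real, Real.norm_of_nonneg (hl i).le]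
    have := (hl i).ne'
    field_simp
  · refine mul_le_mul_of_nonneg_left (le_of_eq ?_) hK
    have h2 : R (∑ i ∈ s, c i • e i) = ∑ i ∈ s, ((l i : ℂ) * c i) • e i := by
      rw [map_sum]
      refine Finset.sum_congr rfl fun i _ => ?_
      rw [map_smul, hRe, smul_smul, mul_comm]
    rw [h2, he.inner_sum, Complex.re_sum]
    refine Finset.sum_congr rfl fun i _ => ?_
    rw [map_mul, Complex.conj_ofReal, mul_assoc, Complex.conj_mul', Complex.re_ofReal_mul]
    norm_cast

omit [Fintype V] in
-- R u = μu holds exactly when A u = (μ⁻¹ - τ²)u, so isospectral Laplacians have resolvents with the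
-- same multiplicities.
theorem eigenspace_resolvent
    (hR : ∀ f u, (u, f - ((τ : ℂ) ^ 2) • u) ∈ G.deltaLaplacianGraph α ↔ R f = u) {μ : ℂ}
    (hμ : μ ≠ 0) :
    Module.End.eigenspace (R : G.L2 →ₗ[ℂ] G.L2) μ =
      eigenspace (G.deltaLaplacian α) (μ⁻¹ - (τ : ℂ) ^ 2) := by
  ext u
  rw [Module.End.mem_eigenspace_iff, ContinuousLinearMap.coe_coe, ← hR, eigenspace,
    graph_deltaLaplacian, Submodule.mem_comap]
  have h1 : (μ • u, u - ((τ : ℂ) ^ 2) • μ • u) =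
      μ • (LinearMap.prod (LinearMap.id : G.L2 →ₗ[ℂ] G.L2)
        ((μ⁻¹ - (τ : ℂ) ^ 2) • LinearMap.id) u) := by
    refine Prod.ext rfl ?_
    change u - ((τ : ℂ) ^ 2) • μ • u = μ • (μ⁻¹ - (τ : ℂ) ^ 2) • u
    rw [smul_smul μ, mul_sub, mul_inv_cancel₀ hμ]
    module
  rw [h1, (G.deltaLaplacianGraph α).smul_mem_iff hμ]

omit [Fintype V] in
theorem eigenspace_resolvent_zero
    (hR : ∀ f u, (u, f - ((τ : ℂ) ^ 2) • u) ∈ G.deltaLaplacianGraph α ↔ R f = u) :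
    Module.End.eigenspace (R : G.L2 →ₗ[ℂ] G.L2) 0 = ⊥ := by
  rw [eq_bot_iff]
  intro u hu
  rw [Module.End.mem_eigenspace_iff, ContinuousLinearMap.coe_coe, zero_smul, ← hR, smul_zero,
    sub_zero] at hu
  exact G.deltaLaplacianGraph_single_valued α _ hu rfl

end Resolvent

/-- Krein's formula for the difference of two resolvents. -/
theorem resolvent_sub {α β : V → ℝ} {τ : ℝ} (hα : G.Admissible α τ) (hβ : G.Admissible β τ)
    {R S : G.L2 →L[ℂ] G.L2}
    (hR : ∀ f u, (u, f - ((τ : ℂ) ^ 2) • u) ∈ G.deltaLaplacianGraph β ↔ R f = u)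
    (hS : ∀ f u, (u, f - ((τ : ℂ) ^ 2) • u) ∈ G.deltaLaplacianGraph α ↔ S f = u) (f : G.L2) :
    R f - S f = ∑ p : V × V, inner ℂ (G.lift τ (Pi.single p.1 1)) f •
      ((((G.vertexMatrix β τ)⁻¹ p.2 p.1 - (G.vertexMatrix α τ)⁻¹ p.2 p.1 : ℝ) : ℂ) •
        G.lift τ (Pi.single p.2 1)) := by
  obtain ⟨U, U', c, H, hm⟩ := resolvent_represents hR f
  obtain ⟨W, W', d, K, km⟩ := resolvent_represents hS f
  -- The two solutions share the right-hand side, so their difference minus the lift of the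
  -- difference of vertex values solves a homogeneous Dirichlet problem and vanishes.
  have h1 := (H.add (K.smul (-1))).add (represents_lift hα.pos (-(c - d)))
  have h2 : R f - S f + G.lift τ (-(c - d)) = 0 := by
    refine Represents.eq_zero_of_value_eq_zero hα.one_le
      (U := fun e x => U e x + -1 * W e x + G.liftFun τ (-(c - d)) e x)
      (U' := fun e x => U' e x + -1 * W' e x + G.liftDeriv τ (-(c - d)) e x) ?_
    convert! h1 using 1
    · ext1 e
      simp
    · ext1 e
      simp [sub_eq_add_neg]
    · module
  have h3 : ∀ b : V → ℂ, G.lift τ b = ∑ l, b l • G.lift τ (Pi.single l 1) := by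
    intro b
    ext1 e
    rw [WithLp.ofLp_sum, Finset.sum_apply]
    simp only [lift, PiLp.smul_apply, smul_add, smul_smul, Finset.sum_add_distrib,
      ← Finset.sum_smul]
    simp [Pi.single_apply]
  have h4 : G.lift τ (-(c - d)) = -∑ l, (c l - d l) • G.lift τ (Pi.single l 1) := by
    rw [h3, ← Finset.sum_neg_distrib]
    refine Finset.sum_congr rfl fun l _ => ?_
    simp only [Pi.neg_apply, Pi.sub_apply, neg_smul]
  rw [h4, ← sub_eq_add_neg, sub_eq_zero] at h2
  rw [h2, Fintype.sum_prod_type, Finset.sum_comm]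
  refine Finset.sum_congr rfl fun l _ => ?_
  rw [H.value_formula hβ hm, K.value_formula hα km, ← Finset.sum_sub_distrib, Finset.sum_smul]
  refine Finset.sum_congr rfl fun k _ => ?_
  rw [smul_smul]
  congr 1
  push_cast
  ring

/-- For isospectral couplings the trace of the difference of the resolvents vanishes. -/
theorem sum_vertexMatrix_inv_sub_mul_inner_eq_zero {α β : V → ℝ} {τ : ℝ}
    (hα : G.Admissible α τ) (hβ : G.Admissible β τ)
    (hspec : Isospectral (G.deltaLaplacian β) (G.deltaLaplacian α)) :
    ∑ k, ∑ l, (((G.vertexMatrix β τ)⁻¹ l k - (G.vertexMatrix α τ)⁻¹ l k : ℝ) : ℂ) *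
      inner ℂ (G.lift τ (Pi.single k 1)) (G.lift τ (Pi.single l 1)) = 0 := by
  obtain ⟨R, hR⟩ := exists_resolvent hβ
  obtain ⟨S, hS⟩ := exists_resolvent hα
  have := sum_inner_eq_zero_of_finrank_eigenspace_eq (isCompactOperator_resolvent hβ hR)
    (isCompactOperator_resolvent hα hS) (resolvent_isSymmetric hR) (resolvent_isSymmetric hS)
    (eigenspace_resolvent_zero hR) (eigenspace_resolvent_zero hS) (fun μ => by
      rcases eq_or_ne μ 0 with rfl | hμ
      · rw [eigenspace_resolvent_zero hR, eigenspace_resolvent_zero hS]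
      · rw [eigenspace_resolvent hR hμ, eigenspace_resolvent hS hμ, Module.finrank,
          Module.finrank, hspec])
    (resolvent_nonneg hβ hR) _
    (fun ι s e l he hl hRe => resolvent_sum_eigenvalues_le hβ hR s e l he hl hRe) _ _
    (resolvent_sub hα hβ hR hS)
  rw [Fintype.sum_prod_type] at this
  simpa only [inner_smul_right] using this

theorem inner_harmonicL2 {a b : ℝ} (hab : a ≤ b) (τ : ℝ) (s t : Bool) :
    inner ℂ (harmonicL2 a b τ s) (harmonicL2 a b τ t) =
      ((∫ x in a..b, harmonic a b τ s x * harmonic a b τ t x : ℝ) : ℂ) := by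
  rw [L2.inner_def, ← intervalIntegral.integral_ofReal, ← setIntegral_Icc_eq_intervalIntegral hab]
  refine integral_congr_ae ?_
  have h : ∀ s, ∀ᵐ x ∂(volume.restrict (Set.Icc a b)),
      harmonicL2 a b τ s x = (harmonic a b τ s x : ℂ) := fun s => coeFn_ofContinuous _
  filter_upwards [h s, h t] with x h1 h2
  rw [h1, h2, RCLike.inner_apply, Complex.conj_ofReal]
  push_cast
  ring

/-- The Gram matrix of the harmonic functions of the vertices. -/
noncomputable def gram (G : MetricGraph E V) (τ : ℝ) : Matrix V V ℝ := fun k l =>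
  ∑ e, ∑ s, ∑ t, if G.vertexOf (e, s) = k ∧ G.vertexOf (e, t) = l then
    ∫ x in (G.left e)..(G.right e), harmonic (G.left e) (G.right e) τ s x *
      harmonic (G.left e) (G.right e) τ t x else 0

theorem conj_ite_mul_ite_mul (p q : Prop) [Decidable p] [Decidable q] (x : ℝ) :
    (if q then 1 else 0) * (conj (if p then 1 else 0 : ℂ) * (x : ℂ)) =
      ((if p ∧ q then x else 0 : ℝ) : ℂ) := by
  split_ifs <;> simp_all

omit [Fintype V] in
theorem inner_lift_lift (τ : ℝ) (k l : V) :
    inner ℂ (G.lift τ (Pi.single k 1)) (G.lift τ (Pi.single l 1)) = (G.gram τ k l : ℂ) := by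
  rw [PiLp.inner_apply, gram, Complex.ofReal_sum]
  refine Finset.sum_congr rfl fun e _ => ?_
  simp only [lift, inner_add_left, inner_add_right, inner_smul_left, inner_smul_right,
    inner_harmonicL2 (G.left_lt_right e).le, Pi.single_apply, Fintype.sum_bool]
  simp only [mul_add, conj_ite_mul_ite_mul]
  push_cast
  ring

end MetricGraph

end QuantumGraph

/-! ### Superpolynomial decay, simple fractions and perturbed diagonal matrices. -/

section Decay

open Filter Topology Asymptotics

theorem superpolynomialDecay_exp_neg_mul {c : ℝ} (hc : 0 < c) :
    SuperpolynomialDecay atTop (fun t : ℝ => t) fun t => Real.exp (-(c * t)) := by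
  intro n
  have h1 : Tendsto (fun t : ℝ => c * t) atTop atTop := tendsto_id.const_mul_atTop hc
  have h2 := ((Real.tendsto_pow_mul_exp_neg_atTop_nhds_zero n).comp h1).const_mul ((c ^ n)⁻¹)
  rw [mul_zero] at h2
  refine h2.congr fun t => ?_
  simp only [Function.comp_apply, mul_pow]
  have := (pow_pos hc n).ne'
  field_simp

theorem Asymptotics.SuperpolynomialDecay.tendsto_zero {f : ℝ → ℝ}
    (hf : SuperpolynomialDecay atTop (fun t : ℝ => t) f) : Tendsto f atTop (𝓝 0) := by
  simpa using hf 0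

theorem Asymptotics.SuperpolynomialDecay.mul_of_abs_le {f g : ℝ → ℝ} {C : ℝ}
    (hf : SuperpolynomialDecay atTop (fun t : ℝ => t) f) (hg : ∀ᶠ t in atTop, |g t| ≤ C) :
    SuperpolynomialDecay atTop (fun t : ℝ => t) fun t => f t * g t := by
  refine (hf.mul_const C).trans_eventually_abs_le ?_
  filter_upwards [hg] with t ht
  simp only [Function.comp_apply, abs_mul]
  exact mul_le_mul_of_nonneg_left (ht.trans (le_abs_self C)) (abs_nonneg _)

theorem Asymptotics.SuperpolynomialDecay.sum {ι : Type*} {s : Finset ι} {f : ι → ℝ → ℝ}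
    (hf : ∀ i ∈ s, SuperpolynomialDecay atTop (fun t : ℝ => t) (f i)) :
    SuperpolynomialDecay atTop (fun t : ℝ => t) fun t => ∑ i ∈ s, f i t := by
  intro n
  have := tendsto_finsetSum s fun i hi => hf i hi n
  simpa [Finset.mul_sum] using this

theorem Asymptotics.SuperpolynomialDecay.abs {f : ℝ → ℝ}
    (hf : SuperpolynomialDecay atTop (fun t : ℝ => t) f) :
    SuperpolynomialDecay atTop (fun t : ℝ => t) fun t => |f t| :=
  hf.trans_abs_le fun t => by simp

theorem tendsto_inv_add_atTop (c : ℝ) : Tendsto (fun t : ℝ => (t + c)⁻¹) atTop (𝓝 0) :=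
  (tendsto_atTop_add_const_right atTop c tendsto_id).inv_tendsto_atTop

/-- If sums of simple fractions agree up to superpolynomially small terms, the power sums of the
poles agree. -/
theorem sum_pow_eq_of_superpolynomialDecay {V : Type*} [Fintype V] (c d : V → ℝ)
    (h : SuperpolynomialDecay atTop (fun t : ℝ => t)
      fun t => ∑ k, ((t + c k)⁻¹ - (t + d k)⁻¹)) (n : ℕ) :
    ∑ k, c k ^ n = ∑ k, d k ^ n := by
  -- Termwise t/(t + c) = 1 - c/(t + c): multiplication by t splits off the n-th power sums and
  -- raises the exponent by one.
  have step : ∀ n : ℕ, ∀ᶠ t in atTop,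
      t * ∑ k, (c k ^ n * (t + c k)⁻¹ - d k ^ n * (t + d k)⁻¹) =
        (∑ k, c k ^ n - ∑ k, d k ^ n) -
          ∑ k, (c k ^ (n + 1) * (t + c k)⁻¹ - d k ^ (n + 1) * (t + d k)⁻¹) := by
    intro n
    have hne : ∀ c : V → ℝ, ∀ᶠ t in atTop, ∀ k, t + c k ≠ 0 := by
      intro c
      refine eventually_all.2 fun k => ?_
      filter_upwards [eventually_gt_atTop (-c k)] with t ht
      linarith
    filter_upwards [hne c, hne d] with t h1 h2
    rw [Finset.mul_sum, ← Finset.sum_sub_distrib, ← Finset.sum_sub_distrib]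
    refine Finset.sum_congr rfl fun k _ => ?_
    have e1 := h1 k
    have e2 := h2 k
    field_simp
    ring
  have hlim : ∀ n : ℕ, Tendsto (fun t : ℝ =>
      ∑ k, (c k ^ n * (t + c k)⁻¹ - d k ^ n * (t + d k)⁻¹)) atTop (𝓝 0) := by
    intro n
    have := tendsto_finsetSum (Finset.univ : Finset V) fun k _ =>
      ((tendsto_inv_add_atTop (c k)).const_mul (c k ^ n)).sub
        ((tendsto_inv_add_atTop (d k)).const_mul (d k ^ n))
    simpa using this
  have hps : ∀ n : ℕ, SuperpolynomialDecay atTop (fun t : ℝ => t) (fun t : ℝ =>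
      ∑ k, (c k ^ n * (t + c k)⁻¹ - d k ^ n * (t + d k)⁻¹)) →
      ∑ k, c k ^ n - ∑ k, d k ^ n = 0 := by
    intro n hn
    have h1 := (hn.param_mul.tendsto_zero.congr' (step n)).add (hlim (n + 1))
    simp only [sub_add_cancel, add_zero] at h1
    exact tendsto_nhds_unique tendsto_const_nhds h1
  -- If the sum with exponent n decays superpolynomially, the n-th power sums agree by `hps`; the
  -- remainder is then -t times a superpolynomially small function, so the induction continues.
  have hdec : ∀ n : ℕ, SuperpolynomialDecay atTop (fun t : ℝ => t) (fun t : ℝ =>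
      ∑ k, (c k ^ n * (t + c k)⁻¹ - d k ^ n * (t + d k)⁻¹)) := by
    intro n
    induction n with
    | zero => simpa using h
    | succ n ih =>
      refine (ih.param_mul.mul_const (-1)).congr' ?_
      filter_upwards [step n] with t ht
      simp only [Pi.mul_apply]
      rw [ht, hps n ih]
      ring
  exact sub_eq_zero.1 (hps n (hdec n))

open scoped Matrix.Norms.Operator in
-- Entrywise decay passes to the submultiplicative operator norm through this bound and returns
-- through `abs_apply_le_norm`.
theorem Matrix.norm_le_sum_abs {V : Type*} [Fintype V] (A : Matrix V V ℝ) :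
    ‖A‖ ≤ ∑ i, ∑ j, |A i j| := by
  rw [Matrix.linfty_opNorm_def]
  have : (∑ i, ∑ j, |A i j| : ℝ) = ((∑ i, ∑ j, ‖A i j‖₊ : NNReal) : ℝ) := by
    push_cast
    rfl
  rw [this, NNReal.coe_le_coe]
  exact Finset.sup_le fun i hi =>
    Finset.single_le_sum (f := fun i => ∑ j, ‖A i j‖₊) (fun _ _ => zero_le) hi

open scoped Matrix.Norms.Operator in
theorem Matrix.abs_apply_le_norm {V : Type*} [Fintype V] (A : Matrix V V ℝ) (i j : V) :
    |A i j| ≤ ‖A‖ := by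
  rw [Matrix.linfty_opNorm_def]
  have h1 : ‖A i j‖₊ ≤ ∑ j, ‖A i j‖₊ :=
    Finset.single_le_sum (f := fun j => ‖A i j‖₊) (fun _ _ => zero_le) (Finset.mem_univ j)
  have h2 := h1.trans (Finset.le_sup (f := fun i => ∑ j, ‖A i j‖₊) (Finset.mem_univ i))
  exact_mod_cast h2

open scoped Matrix.Norms.Operator in
/-- The inverse of a superpolynomially small perturbation of a large diagonal matrix. -/
theorem superpolynomialDecay_inv_sub {V : Type*} [Fintype V] [DecidableEq V] {v : ℝ → V → ℝ}
    {P : ℝ → Matrix V V ℝ} (hv : ∀ᶠ t in atTop, ∀ k, 1 ≤ v t k)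
    (hP : ∀ᶠ t in atTop, IsUnit (P t).det)
    (hd : ∀ k l, SuperpolynomialDecay atTop (fun t : ℝ => t)
      fun t => (P t - Matrix.diagonal (v t)) k l) (k l : V) :
    SuperpolynomialDecay atTop (fun t : ℝ => t)
      fun t => ((P t)⁻¹ - Matrix.diagonal (fun k => (v t k)⁻¹)) k l := by
  have hs : SuperpolynomialDecay atTop (fun t : ℝ => t)
      fun t => ∑ i, ∑ j, |(P t - Matrix.diagonal (v t)) i j| :=
    SuperpolynomialDecay.sum fun i _ => SuperpolynomialDecay.sum fun j _ => (hd i j).abs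
  have hsmall := hs.tendsto_zero.eventually_le_const (show (0 : ℝ) < 1 / 2 by norm_num)
  refine (hs.mul_const 2).trans_eventually_abs_le ?_
  filter_upwards [hv, hP, hsmall] with t h1 h2 h3
  set A := P t - Matrix.diagonal (v t) with hA
  set Δ := Matrix.diagonal (fun k => (v t k)⁻¹) with hΔ
  have hΔ1 : ‖Δ‖ ≤ 1 := by
    rw [hΔ, Matrix.linfty_opNorm_diagonal, pi_norm_le_iff_of_nonneg zero_le_one]
    intro i
    rw [Real.norm_of_nonneg (inv_nonneg.2 (zero_le_one.trans (h1 i)))]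
    exact inv_le_one_of_one_le₀ (h1 i)
  have hvΔ : Matrix.diagonal (v t) * Δ = 1 := by
    rw [hΔ, Matrix.diagonal_mul_diagonal, ← Matrix.diagonal_one]
    congr 1
    ext i
    exact mul_inv_cancel₀ (zero_lt_one.trans_le (h1 i)).ne'
  -- The second resolvent identity, with Δ the inverse of the diagonal part and A the perturbation.
  have hres : (P t)⁻¹ - Δ = -((P t)⁻¹ * A * Δ) := by
    rw [hA, mul_sub, Matrix.nonsing_inv_mul _ h2, sub_mul, one_mul, mul_assoc, hvΔ, mul_one]
    abel
  have hAn : ‖A‖ ≤ ∑ i, ∑ j, |A i j| := Matrix.norm_le_sum_abs A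
  have hdiff : ‖(P t)⁻¹ - Δ‖ ≤ ‖(P t)⁻¹‖ * ‖A‖ := by
    rw [hres, norm_neg]
    calc ‖(P t)⁻¹ * A * Δ‖ ≤ ‖(P t)⁻¹ * A‖ * ‖Δ‖ := norm_mul_le _ _
      _ ≤ ‖(P t)⁻¹‖ * ‖A‖ * 1 := by gcongr; exact norm_mul_le _ _
      _ = _ := mul_one _
  -- A bootstrap: ‖P⁻¹‖ ≤ ‖P⁻¹‖/2 + 1 once the perturbation is at most 1/2.
  have hPn : ‖(P t)⁻¹‖ ≤ 2 := by
    have h4 : ‖(P t)⁻¹‖ ≤ ‖(P t)⁻¹ - Δ‖ + ‖Δ‖ := norm_le_norm_sub_add _ _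
    have h5 := mul_le_mul_of_nonneg_left (hAn.trans h3) (norm_nonneg (P t)⁻¹)
    linarith
  simp only [Function.comp_apply]
  calc |((P t)⁻¹ - Δ) k l| ≤ ‖(P t)⁻¹ - Δ‖ := Matrix.abs_apply_le_norm _ _ _
    _ ≤ ‖(P t)⁻¹‖ * ‖A‖ := hdiff
    _ ≤ 2 * ∑ i, ∑ j, |A i j| := by gcongr
    _ = (∑ i, ∑ j, |A i j|) * 2 := mul_comm _ _
    _ ≤ _ := le_abs_self _

end Decay

/-! ### Large-τ asymptotics of the Dirichlet-to-Neumann and Gram matrices. -/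

namespace QuantumGraph

open Filter Topology Asymptotics

theorem inv_sinh_le {x : ℝ} (hx : 1 ≤ x) : (Real.sinh x)⁻¹ ≤ 4 * Real.exp (-x) := by
  -- For x ≥ 1 one has e^x ≥ 2, hence e^(-x) ≤ 1 ≤ e^x/2.
  have h1 : Real.exp x / 4 ≤ Real.sinh x := by
    rw [Real.sinh_eq]
    have h2 := Real.add_one_le_exp x
    have h3 : Real.exp (-x) ≤ 1 := Real.exp_le_one_iff.2 (by linarith)
    linarith
  calc (Real.sinh x)⁻¹ ≤ (Real.exp x / 4)⁻¹ := by
        gcongr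
    _ = 4 * Real.exp (-x) := by rw [Real.exp_neg, inv_div, div_eq_mul_inv]

theorem superpolynomialDecay_inv_sinh {c : ℝ} (hc : 0 < c) :
    SuperpolynomialDecay atTop (fun t : ℝ => t) fun t => (Real.sinh (t * c))⁻¹ := by
  refine ((superpolynomialDecay_exp_neg_mul hc).const_mul 4).trans_eventually_abs_le ?_
  filter_upwards [eventually_ge_atTop c⁻¹] with t ht
  have h1 : 1 ≤ t * c := by
    rwa [← div_le_iff₀ hc, one_div]
  have h2 : 0 < Real.sinh (t * c) := Real.sinh_pos_iff.2 (by linarith)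
  simp only [Function.comp_apply]
  rw [abs_of_pos (inv_pos.2 h2), abs_of_pos (by positivity), mul_comm c t]
  exact inv_sinh_le h1

theorem coth_sub_one {x : ℝ} (hx : 0 < x) :
    Real.cosh x / Real.sinh x - 1 = (Real.sinh x)⁻¹ * Real.exp (-x) := by
  have h := (Real.sinh_pos_iff.2 hx).ne'
  rw [div_sub_one h, Real.cosh_sub_sinh, div_eq_mul_inv, mul_comm]

theorem superpolynomialDecay_coth_sub_one {c : ℝ} (hc : 0 < c) :
    SuperpolynomialDecay atTop (fun t : ℝ => t)
      fun t => Real.cosh (t * c) / Real.sinh (t * c) - 1 := by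
  have h := (superpolynomialDecay_inv_sinh hc).mul (superpolynomialDecay_exp_neg_mul hc)
  refine h.congr' ?_
  filter_upwards [eventually_gt_atTop 0] with t ht
  rw [coth_sub_one (mul_pos ht hc), Pi.mul_apply, mul_comm c t]

/-- With h the harmonic function and S = sinh(τ(b - a)), h'² = τ²(h² + S⁻²), so (h h'/τ² - x S⁻²)/2
is a primitive of h². The leading term 1/(2τ) does not involve the edge length. -/
theorem integral_harmonic_mul_self {a b τ : ℝ} (h : 0 < τ * (b - a)) (hτ : τ ≠ 0) (s : Bool) :
    ∫ x in a..b, harmonic a b τ s x * harmonic a b τ s x =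
      Real.cosh (τ * (b - a)) / Real.sinh (τ * (b - a)) / (2 * τ) -
        (b - a) / 2 * (Real.sinh (τ * (b - a)))⁻¹ ^ 2 := by
  have hs := (Real.sinh_pos_iff.2 h).ne'
  have hF : ∀ x : ℝ, HasDerivAt (fun x => (harmonic a b τ s x * harmonicDeriv a b τ s x / τ ^ 2 -
      x * (Real.sinh (τ * (b - a)))⁻¹ ^ 2) / 2) (harmonic a b τ s x * harmonic a b τ s x) x := by
    intro x
    have h1 := ((((hasDerivAt_harmonic a b τ s x).mul (hasDerivAt_harmonicDeriv a b τ s x)).div_const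
      (τ ^ 2)).sub ((hasDerivAt_id x).mul_const ((Real.sinh (τ * (b - a)))⁻¹ ^ 2))).div_const 2
    convert! h1 using 1
    have h2 : harmonicDeriv a b τ s x * harmonicDeriv a b τ s x =
        τ ^ 2 * (harmonic a b τ s x ^ 2 + (Real.sinh (τ * (b - a)))⁻¹ ^ 2) := by
      cases s
      · simp only [harmonicDeriv, harmonic, Bool.false_eq_true, if_false]
        have := Real.cosh_sq (τ * (b - x))
        field_simp
        linear_combination this
      · simp only [harmonicDeriv, harmonic, if_true]
        have := Real.cosh_sq (τ * (x - a))
        field_simp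
        linear_combination this
    rw [h2]
    field_simp
    ring
  have hc := continuous_harmonic a b τ s
  rw [intervalIntegral.integral_eq_sub_of_hasDerivAt (fun x _ => hF x)
    ((hc.mul hc).intervalIntegrable _ _)]
  simp only [harmonic_left h, harmonic_right h]
  cases s <;> simp [harmonicDeriv] <;> field_simp <;> ring

/-- By the addition formula sinh(τ(x-a))·sinh(τ(b-x)) ≤ cosh(τ(b-a)); dividing by sinh² leaves an
exponentially small factor times a bounded one. -/
theorem abs_integral_harmonic_mul_le {a b τ : ℝ} (hab : a < b) (hτ : 0 < τ) (s : Bool) :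
    |∫ x in a..b, harmonic a b τ s x * harmonic a b τ (!s) x| ≤
      (b - a) * ((Real.sinh (τ * (b - a)))⁻¹ * (Real.cosh (τ * (b - a)) / Real.sinh (τ * (b - a)))) := by
  have h := mul_pos hτ (sub_pos.2 hab)
  have hs := Real.sinh_pos_iff.2 h
  have hle : ∀ x ∈ Set.uIoc a b, ‖harmonic a b τ s x * harmonic a b τ (!s) x‖ ≤
      (Real.sinh (τ * (b - a)))⁻¹ * (Real.cosh (τ * (b - a)) / Real.sinh (τ * (b - a))) := by
    intro x hx
    rw [Set.uIoc_of_le hab.le] at hx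
    have e1 : harmonic a b τ s x * harmonic a b τ (!s) x =
        (Real.sinh (τ * (b - a)))⁻¹ * ((Real.sinh (τ * (x - a)) * Real.sinh (τ * (b - x))) /
          Real.sinh (τ * (b - a))) := by
      cases s <;> simp [harmonic] <;> ring
    have p1 : 0 ≤ Real.sinh (τ * (x - a)) :=
      Real.sinh_nonneg_iff.2 (mul_nonneg hτ.le (sub_nonneg.2 hx.1.le))
    have p2 : 0 ≤ Real.sinh (τ * (b - x)) :=
      Real.sinh_nonneg_iff.2 (mul_nonneg hτ.le (sub_nonneg.2 hx.2))
    have p3 : Real.sinh (τ * (x - a)) * Real.sinh (τ * (b - x)) ≤ Real.cosh (τ * (b - a)) := by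
      have e2 : τ * (b - a) = τ * (x - a) + τ * (b - x) := by ring
      rw [e2, Real.cosh_add]
      have := mul_pos (Real.cosh_pos (τ * (x - a))) (Real.cosh_pos (τ * (b - x)))
      linarith
    rw [e1, Real.norm_of_nonneg (by positivity)]
    gcongr
  have := intervalIntegral.norm_integral_le_of_norm_le_const hle
  rwa [abs_of_pos (sub_pos.2 hab), mul_comm] at this

namespace MetricGraph

variable {E V : Type*} {G : MetricGraph E V}

/-- The diagonal entries are -τ coth and the off-diagonal ones τ/sinh, so the edge acts like two
independent half-lines. -/
theorem superpolynomialDecay_edgeDtN (e : E) (s t : Bool) :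
    SuperpolynomialDecay atTop (fun τ : ℝ => τ)
      fun τ => G.edgeDtN τ e s t + if s = t then τ else 0 := by
  have hc := sub_pos.2 (G.left_lt_right e)
  by_cases h : s = t
  · refine ((superpolynomialDecay_coth_sub_one hc).param_mul.mul_const (-1)).congr fun τ => ?_
    simp only [edgeDtN, h, if_true, Pi.mul_apply]
    ring
  · refine (superpolynomialDecay_inv_sinh hc).param_mul.congr fun τ => ?_
    simp only [edgeDtN, h, if_false, Pi.mul_apply]
    ring

theorem superpolynomialDecay_integral_harmonic (e : E) (s t : Bool) :
    SuperpolynomialDecay atTop (fun τ : ℝ => τ)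
      fun τ => (∫ x in (G.left e)..(G.right e), harmonic (G.left e) (G.right e) τ s x *
      harmonic (G.left e) (G.right e) τ t x) - if s = t then (2 * τ)⁻¹ else 0 := by
  have hc := sub_pos.2 (G.left_lt_right e)
  have hcoth := superpolynomialDecay_coth_sub_one hc
  have hinv := superpolynomialDecay_inv_sinh hc
  by_cases h : s = t
  · subst h
    have hb : ∀ᶠ τ : ℝ in atTop, |(2 * τ)⁻¹| ≤ 1 := by
      filter_upwards [eventually_ge_atTop 1] with τ hτ
      rw [abs_of_nonneg (by positivity)]
      exact inv_le_one_of_one_le₀ (by linarith)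
    refine ((hcoth.mul_of_abs_le hb).add
      ((hinv.mul hinv).const_mul (-((G.right e - G.left e) / 2)))).congr' ?_
    filter_upwards [eventually_gt_atTop 0] with τ hτ
    rw [integral_harmonic_mul_self (mul_pos hτ hc) hτ.ne']
    simp only [Pi.add_apply, Pi.mul_apply, if_true]
    ring
  · obtain rfl : t = !s := by cases s <;> cases t <;> simp_all
    have hb : ∀ᶠ τ : ℝ in atTop, |Real.cosh (τ * (G.right e - G.left e)) /
        Real.sinh (τ * (G.right e - G.left e))| ≤ 2 := by
      have h1 : Tendsto (fun τ : ℝ => Real.cosh (τ * (G.right e - G.left e)) /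
          Real.sinh (τ * (G.right e - G.left e))) atTop (𝓝 1) := by
        simpa using hcoth.tendsto_zero.add_const 1
      have h2 := h1.abs
      rw [abs_one] at h2
      exact h2.eventually_le_const one_lt_two
    refine ((hinv.mul_of_abs_le hb).const_mul (G.right e - G.left e)).trans_eventually_abs_le ?_
    filter_upwards [eventually_gt_atTop 0] with τ hτ
    simp only [Function.comp_apply, if_neg h, sub_zero]
    exact (abs_integral_harmonic_mul_le (G.left_lt_right e) hτ s).trans (le_abs_self _)

variable [Fintype E] [DecidableEq V]

/-- Only pairs of equal endpoints contribute, and these are counted by the valence. A loop may join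
distinct endpoints of one vertex, but those pairs carry `0`. -/
theorem sum_endpoints_ite (k l : V) (r : ℝ) :
    ∑ e, ∑ s, ∑ t, (if G.vertexOf (e, s) = k ∧ G.vertexOf (e, t) = l then
      (if s = t then r else 0) else 0) = if k = l then (G.valence k : ℝ) * r else 0 := by
  have h1 : ∀ e s, ∑ t, (if G.vertexOf (e, s) = k ∧ G.vertexOf (e, t) = l then
      (if s = t then r else 0) else 0) =
      if G.vertexOf (e, s) = k then (if k = l then r else 0) else 0 := by
    intro e s
    rw [Finset.sum_eq_single s]
    · split_ifs <;> simp_all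
    · intro t _ ht
      simp [ht.symm]
    · simp
  simp only [h1]
  rw [← Fintype.sum_prod_type (f := fun x : E × Bool =>
    if G.vertexOf x = k then (if k = l then r else 0) else 0), ← Finset.sum_filter,
    Finset.sum_const, valence, endpoints]
  split_ifs <;> simp

theorem superpolynomialDecay_dtn (k l : V) :
    SuperpolynomialDecay atTop (fun τ : ℝ => τ)
      fun τ => G.dtn τ k l + if k = l then (G.valence k : ℝ) * τ else 0 := by
  refine SuperpolynomialDecay.congr (f := fun τ => ∑ e, ∑ s, ∑ t,
    if G.vertexOf (e, s) = k ∧ G.vertexOf (e, t) = l then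
      (G.edgeDtN τ e s t + if s = t then τ else 0) else 0) ?_ fun τ => ?_
  · refine SuperpolynomialDecay.sum fun e _ => SuperpolynomialDecay.sum fun s _ =>
      SuperpolynomialDecay.sum fun t _ => ?_
    split_ifs
    · simpa only [*, if_true] using superpolynomialDecay_edgeDtN e s t
    · simpa only [*, if_false] using superpolynomialDecay_edgeDtN e s t
    · exact superpolynomialDecay_zero _ _
  · rw [← sum_endpoints_ite, dtn]
    simp only [← Finset.sum_add_distrib]
    refine Finset.sum_congr rfl fun e _ => Finset.sum_congr rfl fun s _ =>
      Finset.sum_congr rfl fun t _ => ?_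
    split_ifs <;> simp

theorem superpolynomialDecay_gram (k l : V) :
    SuperpolynomialDecay atTop (fun τ : ℝ => τ)
      fun τ => G.gram τ k l - if k = l then (G.valence k : ℝ) * (2 * τ)⁻¹ else 0 := by
  refine SuperpolynomialDecay.congr (f := fun τ => ∑ e, ∑ s, ∑ t,
    if G.vertexOf (e, s) = k ∧ G.vertexOf (e, t) = l then
      ((∫ x in (G.left e)..(G.right e), harmonic (G.left e) (G.right e) τ s x *
      harmonic (G.left e) (G.right e) τ t x) - if s = t then (2 * τ)⁻¹ else 0) else 0) ?_
      fun τ => ?_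
  · refine SuperpolynomialDecay.sum fun e _ => SuperpolynomialDecay.sum fun s _ =>
      SuperpolynomialDecay.sum fun t _ => ?_
    split_ifs
    · simpa only [*, if_true] using superpolynomialDecay_integral_harmonic e s t
    · simpa only [*, if_false] using superpolynomialDecay_integral_harmonic e s t
    · exact superpolynomialDecay_zero _ _
  · rw [← sum_endpoints_ite, gram]
    simp only [← Finset.sum_sub_distrib]
    refine Finset.sum_congr rfl fun e _ => Finset.sum_congr rfl fun s _ =>
      Finset.sum_congr rfl fun t _ => ?_
    split_ifs <;> simp

theorem one_le_valence (k : V) : (1 : ℝ) ≤ G.valence k := by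
  obtain ⟨x, hx⟩ := G.vertexOf_surjective k
  have : 0 < G.valence k := Finset.card_pos.2 ⟨x, Finset.mem_filter.2 ⟨Finset.mem_univ x, hx⟩⟩
  exact_mod_cast this

variable [Fintype V]

omit [DecidableEq V] in
theorem eventually_admissible (α : V → ℝ) : ∀ᶠ τ in atTop, G.Admissible α τ := by
  have h1 : ∀ᶠ τ : ℝ in atTop, ∀ e, 1 ≤ τ * (G.right e - G.left e) := by
    refine eventually_all.2 fun e => ?_
    have hc := sub_pos.2 (G.left_lt_right e)
    filter_upwards [eventually_ge_atTop (G.right e - G.left e)⁻¹] with τ hτ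
    rwa [← div_le_iff₀ hc, one_div]
  filter_upwards [h1, eventually_gt_atTop 0, eventually_ge_atTop (4 * ∑ v, |α v|)]
    with τ h1 h2 h3
  exact ⟨h2, h1, h3⟩

theorem eventually_one_le (α : V → ℝ) :
    ∀ᶠ τ : ℝ in atTop, ∀ k, 1 ≤ α k + G.valence k * τ := by
  refine eventually_all.2 fun k => ?_
  filter_upwards [eventually_ge_atTop (1 - α k), eventually_ge_atTop 0] with τ h1 h2
  nlinarith [one_le_valence (G := G) k]

/-- The vertex matrix is diag(α_k + γ_k τ) up to superpolynomially small entries, and every valence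
is at least one, so the diagonal is eventually bounded below. -/
theorem superpolynomialDecay_vertexMatrix_inv (α : V → ℝ) (k l : V) :
    SuperpolynomialDecay atTop (fun τ : ℝ => τ) fun τ => (G.vertexMatrix α τ)⁻¹ k l -
      if k = l then (α k + G.valence k * τ)⁻¹ else 0 := by
  refine (superpolynomialDecay_inv_sub (eventually_one_le (G := G) α)
    ((eventually_admissible (G := G) α).mono fun τ h => isUnit_det_vertexMatrix h)
    (fun k l => ?_) k l).congr fun τ => ?_
  · refine ((superpolynomialDecay_dtn (G := G) k l).mul_const (-1)).congr fun τ => ?_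
    simp only [vertexMatrix, Matrix.sub_apply, Matrix.diagonal_apply]
    split_ifs <;> ring
  · simp only [Matrix.sub_apply, Matrix.diagonal_apply]

/-- Both factors of the trace identity are replaced by their diagonal leading parts through AQ -
A₀Q₀ = (A - A₀)Q + (Q - Q₀)A₀; eventual boundedness of Q and A₀ suffices. -/
theorem superpolynomialDecay_of_isospectral {α β : V → ℝ}
    (hspec : Isospectral (G.deltaLaplacian β) (G.deltaLaplacian α)) :
    SuperpolynomialDecay atTop (fun τ : ℝ => τ)
      fun τ => ∑ k, ((τ + β k / G.valence k)⁻¹ - (τ + α k / G.valence k)⁻¹) := by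
  let A : V → V → ℝ → ℝ := fun k l τ => (G.vertexMatrix β τ)⁻¹ l k - (G.vertexMatrix α τ)⁻¹ l k
  let A₀ : V → V → ℝ → ℝ := fun k l τ =>
    if l = k then (β l + G.valence l * τ)⁻¹ - (α l + G.valence l * τ)⁻¹ else 0
  let Q₀ : V → V → ℝ → ℝ := fun k l τ => if k = l then (G.valence k : ℝ) * (2 * τ)⁻¹ else 0
  have hA : ∀ k l, SuperpolynomialDecay atTop (fun τ : ℝ => τ) fun τ => A k l τ - A₀ k l τ := by
    intro k l
    refine ((superpolynomialDecay_vertexMatrix_inv (G := G) β l k).add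
      ((superpolynomialDecay_vertexMatrix_inv (G := G) α l k).mul_const (-1))).congr fun τ => ?_
    simp only [A, A₀, Pi.add_apply]
    split_ifs <;> ring
  have hQ₀ : ∀ k l, Tendsto (Q₀ k l) atTop (𝓝 0) := by
    intro k l
    by_cases h : k = l
    · simp only [Q₀, h, if_true]
      have h1 : Tendsto (fun τ : ℝ => 2 * τ) atTop atTop := tendsto_id.const_mul_atTop two_pos
      simpa using h1.inv_tendsto_atTop.const_mul (G.valence l : ℝ)
    · simp only [Q₀, h, if_false]
      exact tendsto_const_nhds
  have hA₀ : ∀ k l, ∀ᶠ τ in atTop, |A₀ k l τ| ≤ 2 := by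
    intro k l
    filter_upwards [eventually_one_le (G := G) α, eventually_one_le (G := G) β] with τ h1 h2
    simp only [A₀]
    have e1 := inv_le_one_of_one_le₀ (h1 l)
    have e2 := inv_le_one_of_one_le₀ (h2 l)
    have e3 := inv_nonneg.2 (zero_le_one.trans (h1 l))
    have e4 := inv_nonneg.2 (zero_le_one.trans (h2 l))
    split_ifs
    · exact abs_le.2 ⟨by linarith, by linarith⟩
    · simp
  have hQ : ∀ k l, ∀ᶠ τ in atTop, |G.gram τ k l| ≤ 1 := by
    intro k l
    have h1 := ((superpolynomialDecay_gram (G := G) k l).tendsto_zero.add (hQ₀ k l)).abs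
    simp only [Q₀, sub_add_cancel, add_zero, abs_zero] at h1
    exact h1.eventually_le_const one_pos
  have hmain : SuperpolynomialDecay atTop (fun τ : ℝ => τ)
      fun τ => ∑ k, ∑ l, (A k l τ * G.gram τ k l - A₀ k l τ * Q₀ k l τ) := by
    refine SuperpolynomialDecay.sum fun k _ => SuperpolynomialDecay.sum fun l _ => ?_
    refine (((hA k l).mul_of_abs_le (hQ k l)).add
      ((superpolynomialDecay_gram (G := G) k l).mul_of_abs_le (hA₀ k l))).congr fun τ => ?_
    simp only [Pi.add_apply, Q₀]
    ring
  -- The trace identity kills ∑ AQ, so `hmain` is -∑ A₀Q₀; the factor -2τ cancels the sign and the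
  -- 1/(2τ) of the Gram matrix.
  refine (hmain.param_mul.mul_const (-2)).congr' ?_
  filter_upwards [eventually_admissible (G := G) α, eventually_admissible (G := G) β,
    eventually_one_le (G := G) α, eventually_one_le (G := G) β] with τ h1 h2 h3 h4
  have htr := sum_vertexMatrix_inv_sub_mul_inner_eq_zero h1 h2 hspec
  simp only [inner_lift_lift, ← Complex.ofReal_mul, ← Complex.ofReal_sum] at htr
  have htr' : ∑ k, ∑ l, A k l τ * G.gram τ k l = 0 := Complex.ofReal_eq_zero.1 htr
  simp only [Pi.mul_apply, Finset.sum_sub_distrib, htr', zero_sub]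
  have hτ := h1.pos.ne'
  have hd : ∀ k, ∑ l, A₀ k l τ * Q₀ k l τ =
      ((β k + G.valence k * τ)⁻¹ - (α k + G.valence k * τ)⁻¹) * (G.valence k * (2 * τ)⁻¹) := by
    intro k
    rw [Finset.sum_eq_single k]
    · simp [A₀, Q₀]
    · intro l _ hl
      simp [A₀, hl]
    · simp
  simp only [hd]
  rw [← Finset.sum_sub_distrib, (fun S => by ring : ∀ S : ℝ, τ * -S * -2 = S * (2 * τ)),
    Finset.sum_mul]
  refine Finset.sum_congr rfl fun k _ => ?_
  have hv : (G.valence k : ℝ) ≠ 0 := (zero_lt_one.trans_le (one_le_valence k)).ne'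
  have hf : ∀ c : ℝ, (τ + c / G.valence k)⁻¹ = G.valence k * (c + G.valence k * τ)⁻¹ := by
    intro c
    rw [show τ + c / G.valence k = (c + G.valence k * τ) / G.valence k by field_simp; ring,
      inv_div, div_eq_mul_inv]
  rw [hf, hf, mul_inv]
  field_simp

end MetricGraph

end QuantumGraph

/-! ### From power sums to the trace formula. -/

/-- Since (1/j)·C(m-1, m-j) = C(m, j)/m, this is the binomial theorem without its term j = 0. With x
+ y and y the two coupling constants at a vertex, it gives a difference of m-th powers. -/
theorem sum_one_div_mul_choose_mul_pow (x y : ℝ) {m : ℕ} (hm : 1 ≤ m) :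
    ∑ j ∈ Finset.Icc 1 m, (1 / (j : ℝ)) * ((m - 1).choose (m - j) : ℝ) * (x ^ j * y ^ (m - j)) =
      ((x + y) ^ m - y ^ m) / m := by
  have hm0 : (m : ℝ) ≠ 0 := by exact_mod_cast (by omega : m ≠ 0)
  have h1 : ∀ j ∈ Finset.Icc 1 m, (1 / (j : ℝ)) * ((m - 1).choose (m - j) : ℝ) *
      (x ^ j * y ^ (m - j)) = (x ^ j * y ^ (m - j) * m.choose j) / m := by
    intro j hj
    obtain ⟨hj1, hj2⟩ := Finset.mem_Icc.1 hj
    obtain ⟨n, rfl⟩ := Nat.exists_eq_add_of_le' hm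
    obtain ⟨i, rfl⟩ := Nat.exists_eq_add_of_le' hj1
    have h2 : (n + 1 - 1).choose (n + 1 - (i + 1)) = n.choose i := by
      rw [Nat.add_sub_cancel, Nat.add_sub_add_right, Nat.choose_symm (by omega)]
    have h3 : ((n + 1 : ℕ) : ℝ) * (n.choose i : ℝ) = ((n + 1).choose (i + 1) : ℝ) * ((i + 1 : ℕ) : ℝ) := by
      exact_mod_cast Nat.add_one_mul_choose_eq n i
    have hi : ((i + 1 : ℕ) : ℝ) ≠ 0 := by positivity
    rw [h2]
    field_simp
    linear_combination x ^ (i + 1) * y ^ (n + 1 - (i + 1)) * h3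
  rw [Finset.sum_congr rfl h1, ← Finset.sum_div, add_pow, Finset.range_eq_Ico,
    Finset.sum_eq_sum_Ico_succ_bot (by omega)]
  simp only [pow_zero, one_mul, Nat.sub_zero, Nat.choose_zero_right, Nat.cast_one, mul_one,
    add_sub_cancel_left, zero_add]
  rfl

theorem theorem3p1 {E V : Type*} [Fintype E] [Fintype V] [DecidableEq V]
    (G : QuantumGraph.MetricGraph E V) (β α : V → ℝ) (B₁ B₂ D : Matrix V V ℝ)
    (hB₁ : B₁ = Matrix.diagonal β) (hB₂ : B₂ = Matrix.diagonal α) (hD : D = B₁ - B₂)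
    (hspec : QuantumGraph.Isospectral (G.deltaLaplacian β) (G.deltaLaplacian α))
    (m : ℕ) (hm : 1 ≤ m) :
    ∑ j ∈ Finset.Icc 1 m, (1 / (j : ℝ)) * ((m - 1).choose (m - j) : ℝ) *
      Matrix.trace (D ^ j * B₂ ^ (m - j) * G.valenceMatrix⁻¹ ^ m) = 0 := by
  have hps := sum_pow_eq_of_superpolynomialDecay _ _
    (QuantumGraph.MetricGraph.superpolynomialDecay_of_isospectral hspec) m
  have hinv : G.valenceMatrix⁻¹ = Matrix.diagonal fun v => (G.valence v : ℝ)⁻¹ := by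
    refine Matrix.inv_eq_right_inv ?_
    rw [QuantumGraph.MetricGraph.valenceMatrix, Matrix.diagonal_mul_diagonal, ← Matrix.diagonal_one]
    congr 1
    ext v
    exact mul_inv_cancel₀
      (zero_lt_one.trans_le (QuantumGraph.MetricGraph.one_le_valence (G := G) v)).ne'
  have hDd : D = Matrix.diagonal (β - α) := by
    rw [hD, hB₁, hB₂, Matrix.diagonal_sub]
    rfl
  have htr : ∀ j, Matrix.trace (D ^ j * B₂ ^ (m - j) * G.valenceMatrix⁻¹ ^ m) =
      ∑ v, ((β v - α v) ^ j * α v ^ (m - j)) * (G.valence v : ℝ)⁻¹ ^ m := by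
    intro j
    rw [hinv, hDd, hB₂, Matrix.diagonal_pow, Matrix.diagonal_pow, Matrix.diagonal_pow,
      Matrix.diagonal_mul_diagonal, Matrix.diagonal_mul_diagonal, Matrix.trace_diagonal]
    rfl
  simp only [htr, Finset.mul_sum, ← mul_assoc]
  rw [Finset.sum_comm]
  simp only [← Finset.sum_mul]
  have h1 : ∀ v, (∑ j ∈ Finset.Icc 1 m, 1 / (j : ℝ) * ((m - 1).choose (m - j) : ℝ) *
      (β v - α v) ^ j * α v ^ (m - j)) * (G.valence v : ℝ)⁻¹ ^ m =
      ((β v / G.valence v) ^ m - (α v / G.valence v) ^ m) / m := by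
    intro v
    have := sum_one_div_mul_choose_mul_pow (β v - α v) (α v) hm
    simp only [← mul_assoc, sub_add_cancel] at this
    rw [this, div_pow, div_pow, inv_pow]
    ring
  simp only [h1]
  rw [← Finset.sum_div, Finset.sum_sub_distrib, hps, sub_self, zero_div]
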